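/- Let $G$ be a locally compact second countable Hausdorff topological group with left Haar measure $m$, and let $A$ be a discrete $G$-module, i.e. a discrete abelian group on which $G$ acts by automorphisms so that the action map $G\times A\to A$ is continuous. For $q\ge 0$ let $\mathcal C(G^q,A)$ be the group of $m^{q}$-a.e. equivalence classes of measurable functions $G^q\to A$ (with $\mathcal C(G^0,A)=A$; measurable means a.e. equal to a Borel function with countable range, which is automatic for Borel functions if $A$ is countable), with the diagonal action $(g\cdot\phi)(g_1,\dots,g_q)=g\cdot\phi(g^{-1}g_1,\dots,g^{-1}g_q)$ and the differential $$d\sigma(g_1,\dots,g_{q+1})=\sum_{i=1}^{q+1}(-1)^{q+1-i}\sigma(g_1,\dots,\widehat{g_i},\dots,g_{q+1}).$$ Let $\mathrm H^p_{\mathrm m}(G,A)$, $p\ge 0$, be the $p$-th cohomology group of the complex $\mathcal C(G,A)^G\xrightarrow{d}\mathcal C(G^2,A)^G\xrightarrow{d}\cdots$, in which $\mathcal C(G^{p+1},A)^G$ is placed in degree $p$ (so $\mathrm H^0_{\mathrm m}(G,A)=A^G$). (1) For every $p\ge 0$, every class in $\mathrm H^p_{\mathrm m}(G,A)$ is represented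 by a function $\sigma:G^{p+1}\to A$ that is $G$-equivariant and satisfies $d\sigma=0$ (both everywhere), that is locally finite-valued (every point of $G^{p+1}$ has a neighbourhood on which $\sigma$ takes only finitely many values), and that is locally constant on a dense open subset of $G^{p+1}$ whose complement is $m^{p+1}$-null. (2) Suppose moreover that $G$ is a closed algebraic subgroup of $\mathrm{GL}_n(\mathbb R)$ for some $n$, i.e. is identified, as a topological group, with a closed subgroup of $\mathrm{GL}_n(\mathbb R)$ that is the set of all invertible matrices at which a family of real polynomials in the $n^2$ matrix entries vanish. Then for every $p\ge 0$ every class in $\mathrm H^p_{\mathrm m}(G,A)$ is represented by a function $\sigma:G^{p+1}\to A$ that has all the properties in (1), that is constant on each cell of some locally finite partition of $G^{p+1}$ into semi-algebraic subsets of the real affine space $M_{n\times n}(\mathbb R)^{p+1}$, and that is constant on a neighbourhood of the origin $(e,\dots,e)$ of $G^{p+1}$. -/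

import Mathlib

open MeasureTheory Topology Filter

set_option linter.unusedSectionVars false

/-! ### The measurable homogeneous bar resolution

Throughout, `G` is a locally compact second countable group with a left Haar measure `μ`, and `A` is
a topological `G`-module. `G^q` is `Fin q → G` with the product measure. -/

namespace MooreCohomology

universe u v

/-- `G^q` carries the product of the Haar measures of the factors, a Haar measure of `G^q`. -/
noncomputable abbrev powMeasure {G : Type u} [MeasurableSpace G] (μ : Measure G) (q : ℕ) :
    Measure (Fin q → G) :=
  Measure.pi fun _ => μ

/-- `𝒞(G^q, A)`: the a.e. classes of (strongly) measurable functions `G^q → A`; for a Polish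
module `A`, in particular for a countable discrete one, these are all measurable functions. (For `q = 0` the space `G^0` is
one point of mass one, and this is `A` itself.) -/
abbrev Cochain {G : Type u} [MeasurableSpace G] (μ : Measure G) (A : Type v) [TopologicalSpace A]
    (q : ℕ) : Type (max u v) :=
  (Fin q → G) →ₘ[powMeasure μ q] A

/-- The diagonal left translation of `G^q` by `g`. -/
theorem measurePreserving_diag {G : Type u} [Group G] [MeasurableSpace G] [MeasurableMul G]
    (μ : Measure G) [SigmaFinite μ] [μ.IsMulLeftInvariant] (q : ℕ) (g : G) :
    MeasurePreserving (fun (x : Fin q → G) (i : Fin q) => g * x i) (powMeasure μ q)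
      (powMeasure μ q) :=
  measurePreserving_pi _ _ fun _ => measurePreserving_mul_left μ g

/-- Omitting the `i`-th coordinate. -/
theorem quasiMeasurePreserving_face {G : Type u} [MeasurableSpace G] (μ : Measure G) [SigmaFinite μ]
    (q : ℕ) (i : Fin (q + 1)) :
    Measure.QuasiMeasurePreserving (fun (x : Fin (q + 1) → G) (j : Fin q) => x (i.succAbove j))
      (powMeasure μ (q + 1)) (powMeasure μ q) :=
  Measure.quasiMeasurePreserving_snd.comp
    (measurePreserving_piFinSuccAbove (fun _ : Fin (q + 1) => μ) i).quasiMeasurePreserving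

variable {G : Type u} [Group G] [TopologicalSpace G] [IsTopologicalGroup G] [MeasurableSpace G]
  [BorelSpace G] (μ : Measure G) [SigmaFinite μ] (A : Type v) [AddCommGroup A] [TopologicalSpace A]
  [IsTopologicalAddGroup A]

/-- The diagonal action of `g` on `𝒞(G^q, A)`:
`(g • φ)(g₁, …, g_q) = g • φ(g⁻¹ g₁, …, g⁻¹ g_q)`. -/
noncomputable def act [μ.IsMulLeftInvariant] [DistribMulAction G A] [ContinuousSMul G A] (q : ℕ)
    (g : G) : Cochain μ A q →+ Cochain μ A q where
  toFun φ := AEEqFun.comp (fun a : A => g • a) (continuous_const_smul g)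
    (φ.compMeasurePreserving (fun x i => g⁻¹ * x i) (measurePreserving_diag μ q g⁻¹))
  map_zero' := by
    refine AEEqFun.ext ?_
    refine (AEEqFun.coeFn_comp _ _ _).trans ?_
    have h := AEEqFun.coeFn_compMeasurePreserving (0 : Cochain μ A q)
      (measurePreserving_diag μ q g⁻¹)
    have h0 := (measurePreserving_diag μ q g⁻¹).quasiMeasurePreserving.ae_eq_comp
      (AEEqFun.coeFn_zero (μ := powMeasure μ q) (β := A))
    filter_upwards [h, h0, AEEqFun.coeFn_zero (μ := powMeasure μ q) (β := A)] with x h1 h2 h3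
    simp only [Function.comp_apply] at h1 h2 ⊢
    rw [h1, h2, h3]
    simp
  map_add' φ ψ := by
    refine AEEqFun.ext ?_
    refine (AEEqFun.coeFn_comp _ _ _).trans ?_
    refine EventuallyEq.trans ?_ (AEEqFun.coeFn_add _ _).symm
    have hm := measurePreserving_diag μ q g⁻¹
    filter_upwards [AEEqFun.coeFn_compMeasurePreserving (φ + ψ) hm,
      AEEqFun.coeFn_compMeasurePreserving φ hm, AEEqFun.coeFn_compMeasurePreserving ψ hm,
      hm.quasiMeasurePreserving.ae_eq_comp (AEEqFun.coeFn_add φ ψ),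
      AEEqFun.coeFn_comp (fun a : A => g • a) (continuous_const_smul g)
        (φ.compMeasurePreserving _ hm),
      AEEqFun.coeFn_comp (fun a : A => g • a) (continuous_const_smul g)
        (ψ.compMeasurePreserving _ hm)] with x h1 h2 h3 h4 h5 h6
    simp only [Function.comp_apply, Pi.add_apply] at h1 h2 h3 h4 h5 h6 ⊢
    rw [h5, h6, h1, h2, h3, h4, smul_add]

/-- The subgroup `𝒞(G^q, A)^G` of classes fixed by the diagonal action. -/
noncomputable def invariants [μ.IsMulLeftInvariant] [DistribMulAction G A] [ContinuousSMul G A]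
    (q : ℕ) : AddSubgroup (Cochain μ A q) :=
  ⨅ g : G, (act μ A q g).eqLocus (AddMonoidHom.id _)

/-- The `i`-th face map `𝒞(G^q, A) → 𝒞(G^(q+1), A)`, precomposition with omission of the `i`-th
coordinate. -/
noncomputable def face (q : ℕ) (i : Fin (q + 1)) : Cochain μ A q →+ Cochain μ A (q + 1) where
  toFun σ := σ.compQuasiMeasurePreserving (fun x j => x (i.succAbove j))
    (quasiMeasurePreserving_face μ q i)
  map_zero' := by
    refine AEEqFun.ext ?_
    have hm := quasiMeasurePreserving_face μ q i
    exact (AEEqFun.coeFn_compQuasiMeasurePreserving _ hm).trans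
      ((hm.ae_eq_comp AEEqFun.coeFn_zero).trans AEEqFun.coeFn_zero.symm)
  map_add' σ τ := by
    refine AEEqFun.ext ?_
    refine EventuallyEq.trans ?_ (AEEqFun.coeFn_add _ _).symm
    have hm := quasiMeasurePreserving_face μ q i
    filter_upwards [AEEqFun.coeFn_compQuasiMeasurePreserving (σ + τ) hm,
      AEEqFun.coeFn_compQuasiMeasurePreserving σ hm, AEEqFun.coeFn_compQuasiMeasurePreserving τ hm,
      hm.ae_eq_comp (AEEqFun.coeFn_add σ τ)] with x h1 h2 h3 h4
    simp only [Function.comp_apply, Pi.add_apply] at h1 h2 h3 h4 ⊢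
    rw [h1, h2, h3, h4]

/-- The differential `𝒞(G^q, A) → 𝒞(G^(q+1), A)`, the alternating sum of the face maps, with sign
`+1` at the last one. -/
noncomputable def d (q : ℕ) : Cochain μ A q →+ Cochain μ A (q + 1) :=
  ∑ i : Fin (q + 1), (-1 : ℤ) ^ (q - (i : ℕ)) • face μ A q i

theorem coeFn_face (q : ℕ) (i : Fin (q + 1)) (σ : Cochain μ A q) :
    ⇑(face μ A q i σ) =ᵐ[powMeasure μ (q + 1)] fun x => σ (fun j => x (i.succAbove j)) :=
  AEEqFun.coeFn_compQuasiMeasurePreserving _ (quasiMeasurePreserving_face μ q i)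

theorem face_face (q : ℕ) (i : Fin (q + 2)) (j : Fin (q + 1)) (σ : Cochain μ A q) :
    face μ A (q + 1) i (face μ A q j σ) =
      face μ A (q + 1) (i.succAbove j) (face μ A q (j.predAbove i) σ) := by
  refine AEEqFun.ext ?_
  refine (coeFn_face μ A _ _ _).trans (EventuallyEq.trans ?_ (coeFn_face μ A _ _ _).symm)
  have h1 := (quasiMeasurePreserving_face μ (q + 1) i).ae_eq_comp (coeFn_face μ A q j σ)
  have h2 := (quasiMeasurePreserving_face μ (q + 1) (i.succAbove j)).ae_eq_comp
    (coeFn_face μ A q (j.predAbove i) σ)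
  refine h1.trans (EventuallyEq.trans ?_ h2.symm)
  refine Eventually.of_forall fun x => ?_
  simp only [Function.comp_apply, Fin.succAbove_succAbove_succAbove_predAbove]

theorem d_apply (q : ℕ) (σ : Cochain μ A q) :
    d μ A q σ = ∑ i : Fin (q + 1), (-1 : ℤ) ^ (q - (i : ℕ)) • face μ A q i σ := by
  simp [d]

theorem d_d (q : ℕ) (σ : Cochain μ A q) : d μ A (q + 1) (d μ A q σ) = 0 := by
  simp only [d_apply, map_sum, map_zsmul, Finset.smul_sum, smul_smul]
  rw [Finset.sum_comm, ← Fintype.sum_prod_type' (f := fun (i : Fin (q + 2)) (j : Fin (q + 1)) =>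
    ((-1 : ℤ) ^ (q - (j : ℕ)) * (-1) ^ (q + 1 - (i : ℕ))) • face μ A (q + 1) i (face μ A q j σ))]
  refine Finset.sum_involution (fun ij _ => (ij.1.succAbove ij.2, ij.2.predAbove ij.1)) ?_ ?_ ?_ ?_
  · rintro ⟨i, j⟩ -
    dsimp only
    rw [← face_face, ← add_smul]
    convert zero_smul ℤ _
    have hi := i.2
    have hj := j.2
    rw [← pow_add, ← pow_add]
    rcases lt_or_ge j.castSucc i with h | h
    · rw [Fin.succAbove_of_castSucc_lt _ _ h, Fin.predAbove_of_castSucc_lt _ _ h]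
      have h' : (j : ℕ) < i := h
      simp only [Fin.val_castSucc, Fin.val_pred]
      rw [show q - ((i : ℕ) - 1) + (q + 1 - (j : ℕ)) = q - (j : ℕ) + (q + 1 - (i : ℕ)) + 1 by omega,
        pow_succ]
      ring
    · rw [Fin.succAbove_of_le_castSucc _ _ h, Fin.predAbove_of_le_castSucc _ _ h]
      have h' : (i : ℕ) ≤ j := h
      simp only [Fin.val_succ, Fin.coe_castPred]
      rw [show q - (j : ℕ) + (q + 1 - (i : ℕ)) = q - (i : ℕ) + (q + 1 - ((j : ℕ) + 1)) + 1 by omega,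
        pow_succ]
      ring
  · rintro ⟨i, j⟩ - -
    simp [Fin.succAbove_ne]
  · simp
  · rintro ⟨i, j⟩ -
    simp [Fin.succAbove_succAbove_predAbove, Fin.predAbove_predAbove_succAbove]

variable [μ.IsMulLeftInvariant] [DistribMulAction G A] [ContinuousSMul G A]

theorem coeFn_act (q : ℕ) (g : G) (φ : Cochain μ A q) :
    ⇑(act μ A q g φ) =ᵐ[powMeasure μ q] fun x => g • φ (fun i => g⁻¹ * x i) := by
  refine (AEEqFun.coeFn_comp (fun a : A => g • a) (continuous_const_smul g) _).trans ?_
  filter_upwards [AEEqFun.coeFn_compMeasurePreserving φ (measurePreserving_diag μ q g⁻¹)] with x hx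
  exact congrArg (g • ·) hx

theorem mem_invariants (q : ℕ) (φ : Cochain μ A q) :
    φ ∈ invariants μ A q ↔ ∀ g : G, act μ A q g φ = φ := by
  simp only [invariants, AddSubgroup.mem_iInf]
  exact Iff.rfl

theorem act_face (q : ℕ) (g : G) (i : Fin (q + 1)) (φ : Cochain μ A q) :
    act μ A (q + 1) g (face μ A q i φ) = face μ A q i (act μ A q g φ) := by
  refine AEEqFun.ext ?_
  refine (coeFn_act μ A _ _ _).trans (EventuallyEq.trans ?_ (coeFn_face μ A _ _ _).symm)
  have h1 := (measurePreserving_diag μ (q + 1) g⁻¹).quasiMeasurePreserving.ae_eq_comp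
    (coeFn_face μ A q i φ)
  have h2 := (quasiMeasurePreserving_face μ q i).ae_eq_comp (coeFn_act μ A q g φ)
  filter_upwards [h1, h2] with x h1 h2
  simp only [Function.comp_apply] at h1 h2
  rw [h1, h2]

/-- The cocycles of degree `p`: the kernel of `d` on `𝒞(G^(p+1), A)^G`. -/
noncomputable def cocycles (p : ℕ) : AddSubgroup (Cochain μ A (p + 1)) :=
  invariants μ A (p + 1) ⊓ (d μ A (p + 1)).ker

/-- The coboundaries of degree `p`: the image of `d` on `𝒞(G^p, A)^G` for `p ≥ 1`, and `0` for
`p = 0`, where the complex `𝒞(G, A)^G → 𝒞(G², A)^G → ⋯` begins. -/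
noncomputable def coboundaries : (p : ℕ) → AddSubgroup (Cochain μ A (p + 1))
  | 0 => ⊥
  | p + 1 => (invariants μ A (p + 1)).map (d μ A (p + 1))

/-- The coboundaries are cocycles. -/
theorem coboundaries_le_cocycles (p : ℕ) : coboundaries μ A p ≤ cocycles μ A p := by
  cases p with
  | zero => exact bot_le
  | succ p =>
    rintro _ ⟨φ, hφ, rfl⟩
    refine ⟨(mem_invariants μ A _ _).2 fun g => ?_, d_d μ A _ _⟩
    have h := (mem_invariants μ A _ _).1 hφ g
    simp only [d_apply, map_sum, map_zsmul, act_face, h]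

/-- Moore's measurable cohomology group `H^p_m(G, A)`. -/
abbrev Hm (p : ℕ) : Type (max u v) :=
  cocycles μ A p ⧸ (coboundaries μ A p).addSubgroupOf (cocycles μ A p)

variable {A}

/-- The everywhere defined function `σ : G^(p+1) → A` is a homogeneous cocycle (`G`-equivariant and
in the kernel of the alternating-sum differential), and its a.e. class is measurable and lies in
the cohomology class `c`. -/
structure Represents {p : ℕ} (c : Hm μ A p) (σ : (Fin (p + 1) → G) → A) : Prop where
  equivariant : ∀ (g : G) (x : Fin (p + 1) → G), σ (fun i => g * x i) = g • σ x
  cocycle : ∀ x : Fin (p + 2) → G,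
    ∑ i : Fin (p + 2), (-1 : ℤ) ^ (p + 1 - (i : ℕ)) • σ (fun j => x (i.succAbove j)) = 0
  mem_class : ∃ z : cocycles μ A p,
    (QuotientAddGroup.mk z : Hm μ A p) = c ∧ ⇑(z : Cochain μ A (p + 1)) =ᵐ[powMeasure μ (p + 1)] σ

end MooreCohomology

/-! ### Regularity of functions -/

/-- Every point has a neighbourhood on which `f` takes only finitely many values. -/
def LocallyFiniteValued {X A : Type*} [TopologicalSpace X] (f : X → A) : Prop :=
  ∀ x : X, ∃ U ∈ 𝓝 x, (f '' U).Finite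

/-- `f` is locally constant on some dense open set whose complement is null. -/
def LocallyConstantOnFullDenseOpen {X A : Type*} [TopologicalSpace X] [MeasurableSpace X]
    (ν : Measure X) (f : X → A) : Prop :=
  ∃ U : Set X, IsOpen U ∧ Dense U ∧ ν Uᶜ = 0 ∧ ∀ x ∈ U, ∀ᶠ y in 𝓝 x, f y = f x

/-! ### Semi-algebraic sets and algebraic matrix groups -/

/-- The semi-algebraic subsets of the affine space `ℝ^ι`: the smallest class that contains all sets
`{x | f x > 0}`, `f` a polynomial, and is closed under complements and finite intersections
(hence also under finite unions). -/
inductive IsSemialgebraic {ι : Type*} : Set (ι → ℝ) → Prop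
  | pos (f : MvPolynomial ι ℝ) : IsSemialgebraic {x | 0 < MvPolynomial.eval x f}
  | compl {S : Set (ι → ℝ)} : IsSemialgebraic S → IsSemialgebraic Sᶜ
  | inter {S T : Set (ι → ℝ)} : IsSemialgebraic S → IsSemialgebraic T → IsSemialgebraic (S ∩ T)

/-- A subgroup of `GL_n(ℝ)` is algebraic if it is the set of invertible matrices at which all the
polynomials of some set, in the `n²` matrix entries, vanish. -/
def IsAlgebraicSubgroup {n : ℕ} (H : Subgroup (GL (Fin n) ℝ)) : Prop :=
  ∃ S : Set (MvPolynomial (Fin n × Fin n) ℝ),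
    ∀ g : GL (Fin n) ℝ, g ∈ H ↔
      ∀ f ∈ S, MvPolynomial.eval (fun k => (g : Matrix (Fin n) (Fin n) ℝ) k.1 k.2) f = 0

/-- The coordinates of a `q`-tuple of elements of a matrix group `ρ : G → GL_n(ℝ)`, as a point of the
affine space `M_{n×n}(ℝ)^q` of `q`-tuples of matrices. -/
def matrixCoords {G : Type*} [Group G] {n : ℕ} (ρ : G →* GL (Fin n) ℝ) (q : ℕ) (x : Fin q → G) :
    Fin q × Fin n × Fin n → ℝ :=
  fun k => (ρ (x k.1) : Matrix (Fin n) (Fin n) ℝ) k.2.1 k.2.2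

/-- `f` is constant on every cell of some locally finite partition of `G^q` into sets that are
semi-algebraic in the space of `q`-tuples of matrices. -/
def IsSemialgebraicallyPartitioned {G : Type*} [Group G] [TopologicalSpace G] {A : Type*} {n : ℕ}
    (ρ : G →* GL (Fin n) ℝ) {q : ℕ} (f : (Fin q → G) → A) : Prop :=
  ∃ P : Set (Set (Fin q → G)), Setoid.IsPartition P ∧
    LocallyFinite (Subtype.val : P → Set (Fin q → G)) ∧
    (∀ C ∈ P, IsSemialgebraic (matrixCoords ρ q '' C)) ∧
    ∀ C ∈ P, ∀ x ∈ C, ∀ y ∈ C, f x = f y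

/-! A class is first represented by a measurable, everywhere equivariant `σ` with values in a
countable submodule. View `σ y` as a function `φ x y` of `x ∈ G^1` and `y ∈ G^(p+1)` that does not
depend on `x`, and descend through the double complex of equivariant functions on `G^(k+1) ×
G^(b+1)`, `k + b = p`: solve `∂_y τ = φ` and continue with `±∂_x τ`, which has one more `x` and one
fewer `y`. When no `y` is left, `τ` is a cocycle in `x ∈ G^(p+1)` alone.

The gain is regularity in `x`. Call a family tame if for every `ε` the parameter space has a locally
finite labelling by good pieces such that members with the same label differ on a set of measure at
most `ε`. The initial family is constant, hence tame. Primitives can be chosen tame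
(`IsTame.exists_primitive`): freezing one variable gives primitives with no larger support, and a
telescoping series of small primitives converges by Borel–Cantelli. They are found on the slice `x 0
= 1` and extended equivariantly, which preserves tameness because translation is continuous in
measure (`IsTame.homogenize`). At the end `y` ranges over the one-point space `G^0` of mass one, so
tolerance `1/2` makes `τ` constant on the pieces. Pieces have null frontier, which gives the local
constancy.

To compare `τ` with `σ`, functions on the double complex are restricted along `z ↦ (z₀h, …, z_k h;
z_k, …, z_p)`; a Leibniz-type identity (`spread_coboundary`) makes consecutive restrictions
cohomologous. Since `∂_y τ = φ` holds only for almost every `y`, a generic right translation `h` is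
needed (`ae_ae_spread`); it commutes with the left action. The result is `z ↦ τ(zh) = h • τ(h⁻¹zh)`,
constant near the origin because `τ` is.

The two parts differ only in the algebra of pieces: all Borel sets with null frontier, or those of
them that are semi-algebraic. -/

namespace MooreCohomology

open scoped ENNReal

/-! ### Labellings and tame families -/

section Labels

variable {X X' Y B : Type*} [TopologicalSpace X] [TopologicalSpace X']

/-- A Boolean algebra of subsets of `X` that contains a neighbourhood basis of open sets. -/
structure IsTopBooleanAlgebra (𝒩 : Set (Set X)) : Prop where
  compl : ∀ C ∈ 𝒩, Cᶜ ∈ 𝒩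
  inter : ∀ C ∈ 𝒩, ∀ D ∈ 𝒩, C ∩ D ∈ 𝒩
  univ : Set.univ ∈ 𝒩
  basis : ∀ x, ∀ U ∈ 𝓝 x, ∃ W ∈ 𝒩, IsOpen W ∧ x ∈ W ∧ W ⊆ U

namespace IsTopBooleanAlgebra

variable {𝒩 : Set (Set X)}

theorem empty (h𝒩 : IsTopBooleanAlgebra 𝒩) : ∅ ∈ 𝒩 := by simpa using h𝒩.compl _ h𝒩.univ

theorem iInter_lt (h𝒩 : IsTopBooleanAlgebra 𝒩) {W : ℕ → Set X} (hW : ∀ i, W i ∈ 𝒩)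
    (n : ℕ) : {x | ∀ j < n, x ∈ W j} ∈ 𝒩 := by
  induction n with
  | zero => simpa using h𝒩.univ
  | succ n ih =>
    convert h𝒩.inter _ ih _ (hW n) using 1
    ext x
    simp only [Set.mem_ofPred_eq, Set.mem_inter_iff, Nat.lt_succ_iff_lt_or_eq]
    exact ⟨fun h => ⟨fun j hj => h j (Or.inl hj), h n (Or.inr rfl)⟩,
      fun h j hj => hj.elim (h.1 j) fun e => e ▸ h.2⟩

end IsTopBooleanAlgebra

/-- A labelling of the points of `X` by natural numbers, whose level sets belong to `𝒩`, that is
locally finite-valued, and constant near the base point. -/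
structure IsLabel (𝒩 : Set (Set X)) (x₀ : X) (N : X → ℕ) : Prop where
  mem : ∀ n, N ⁻¹' {n} ∈ 𝒩
  locFin : ∀ x, ∃ S : Set ℕ, S.Finite ∧ ∀ᶠ y in 𝓝 x, N y ∈ S
  near : ∀ᶠ y in 𝓝 x₀, N y = N x₀

theorem IsLabel.const {𝒩 : Set (Set X)} (h𝒩 : IsTopBooleanAlgebra 𝒩) (x₀ : X) (n : ℕ) :
    IsLabel 𝒩 x₀ fun _ => n where
  mem m := by
    by_cases h : n = m
    · convert h𝒩.univ; ext; simp [h]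
    · convert h𝒩.empty; ext; simp [h]
  locFin _ := ⟨{n}, Set.finite_singleton n, by simp⟩
  near := by simp

theorem IsLabel.pair {𝒩 : Set (Set X)} (h𝒩 : IsTopBooleanAlgebra 𝒩) {x₀ : X} {N N' : X → ℕ}
    (h : IsLabel 𝒩 x₀ N) (h' : IsLabel 𝒩 x₀ N') : IsLabel 𝒩 x₀ fun x => Nat.pair (N x) (N' x) where
  mem n := by
    convert h𝒩.inter _ (h.mem n.unpair.1) _ (h'.mem n.unpair.2) using 1
    ext x
    simp only [Set.mem_preimage, Set.mem_singleton_iff, Set.mem_inter_iff]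
    constructor
    · rintro rfl; simp
    · rintro ⟨h1, h2⟩; rw [h1, h2, Nat.pair_unpair]
  locFin x := by
    obtain ⟨S, hS, hx⟩ := h.locFin x
    obtain ⟨S', hS', hx'⟩ := h'.locFin x
    refine ⟨Set.image2 Nat.pair S S', hS.image2 _ hS', ?_⟩
    filter_upwards [hx, hx'] with y h1 h2 using Set.mem_image2_of_mem h1 h2
  near := by filter_upwards [h.near, h'.near] with y h1 h2; rw [h1, h2]

theorem IsLabel.comp {𝒩 : Set (Set X)} {𝒩' : Set (Set X')} {x₀ : X} {x₀' : X'} {f : X' → X}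
    {N : X → ℕ} (h : IsLabel 𝒩 x₀ N) (hf : Continuous f) (hm : ∀ C ∈ 𝒩, f ⁻¹' C ∈ 𝒩')
    (h0 : f x₀' = x₀) : IsLabel 𝒩' x₀' (N ∘ f) where
  mem n := hm _ (h.mem n)
  locFin x := by
    obtain ⟨S, hS, hx⟩ := h.locFin (f x)
    exact ⟨S, hS, hf.continuousAt.eventually hx⟩
  near := by
    subst h0
    exact hf.continuousAt.eventually h.near

/-- Labellings can be glued from local ones. -/
theorem exists_isLabel_of_local [SecondCountableTopology X] {𝒩 : Set (Set X)}
    (h𝒩 : IsTopBooleanAlgebra 𝒩) (x₀ : X) {R : X → X → Prop}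
    (H : ∀ x, ∃ U ∈ 𝓝 x, ∃ N, IsLabel 𝒩 x₀ N ∧ ∀ z ∈ U, ∀ z' ∈ U, N z = N z' → R z z') :
    ∃ N, IsLabel 𝒩 x₀ N ∧ ∀ z z', N z = N z' → R z z' := by
  choose U hU N hN hR using H
  choose W hW𝒩 hWo hxW hWU using fun x => h𝒩.basis x (U x) (hU x)
  obtain ⟨s, hs, hsW⟩ := TopologicalSpace.isOpen_iUnion_countable W hWo
  have hcov : ⋃ x, W x = Set.univ := Set.eq_univ_of_forall fun x => Set.mem_iUnion.2 ⟨x, hxW x⟩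
  obtain ⟨e, he⟩ := (hs.insert x₀).exists_eq_range (Set.insert_nonempty _ _)
  -- the sequence of centres, starting with the base point
  let c : ℕ → X := fun n => Nat.casesOn n x₀ e
  have hc : ∀ x, ∃ n, x ∈ W (c n) := by
    intro x
    have hx : x ∈ ⋃ i ∈ s, W i := by rw [hsW, hcov]; trivial
    simp only [Set.mem_iUnion] at hx
    obtain ⟨i, hi, hx⟩ := hx
    have : i ∈ Set.range e := he ▸ Set.mem_insert_of_mem _ hi
    obtain ⟨n, rfl⟩ := this
    exact ⟨n + 1, hx⟩
  classical
  let i : X → ℕ := fun x => Nat.find (hc x)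
  have hi : ∀ x, x ∈ W (c (i x)) := fun x => Nat.find_spec (hc x)
  have hi' : ∀ x n, x ∈ W (c n) → i x ≤ n := fun x n h => Nat.find_min' (hc x) h
  have hin : ∀ x n, i x = n ↔ x ∈ W (c n) ∧ ∀ j < n, x ∈ (W (c j))ᶜ := by
    intro x n
    exact Nat.find_eq_iff (hc x)
  have him : ∀ n, i ⁻¹' {n} ∈ 𝒩 := by
    intro n
    convert h𝒩.inter _ (hW𝒩 (c n)) _
      (h𝒩.iInter_lt (fun j => h𝒩.compl _ (hW𝒩 (c j))) n) using 1
    ext x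
    exact hin x n
  -- The label of `x` records the first open set `W (c n)` containing `x` and the local label
  -- attached to its centre.
  refine ⟨fun x => Nat.pair (i x) (N (c (i x)) x), ⟨fun n => ?_, fun x => ?_, ?_⟩, ?_⟩
  · convert h𝒩.inter _ (him n.unpair.1) _ ((hN (c n.unpair.1)).mem n.unpair.2) using 1
    ext x
    simp only [Set.mem_preimage, Set.mem_singleton_iff, Set.mem_inter_iff]
    constructor
    · rintro rfl; simp
    · rintro ⟨h1, h2⟩; rw [h1, h2, Nat.pair_unpair]
  · choose S hS hSx using fun j => (hN (c j)).locFin x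
    -- Throughout the neighbourhood `W (c (i x))` the first index is at most `i x`, so only finitely
    -- many local labellings are involved.
    refine ⟨⋃ j ∈ Set.Iic (i x), Nat.pair j '' S j,
      (Set.finite_Iic _).biUnion fun j _ => (hS j).image _, ?_⟩
    have h1 : ∀ᶠ y in 𝓝 x, ∀ j ∈ Set.Iic (i x), N (c j) y ∈ S j :=
      (Set.finite_Iic _).eventually_all.2 fun j _ => hSx j
    filter_upwards [h1, (hWo (c (i x))).mem_nhds (hi x)] with y hy hyW
    have := hi' y _ hyW
    exact Set.mem_biUnion (show i y ∈ Set.Iic (i x) from this) ⟨_, hy _ this, rfl⟩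
  -- As `x₀` is the centre number zero, the first index is `0` on all of `W x₀`.
  · have h0 : ∀ y ∈ W x₀, i y = 0 := fun y hy => Nat.le_zero.1 (hi' y 0 hy)
    filter_upwards [(hWo x₀).mem_nhds (hxW x₀), (hN x₀).near] with y hy hy'
    rw [h0 y hy, h0 x₀ (hxW x₀)]
    exact congrArg _ hy'
  · intro z z' hz
    obtain ⟨h1, h2⟩ := Nat.pair_eq_pair.1 hz
    have hz' := hi z'
    rw [← h1] at hz' h2
    exact hR (c (i z)) z (hWU _ (hi z)) z' (hWU _ hz') h2

variable [MeasurableSpace Y]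

/-- The family `φ` of functions on `Y`, indexed by `X`, is up to a set of small measure `ν` constant
on the level sets of a labelling. -/
def IsTame (𝒩 : Set (Set X)) (x₀ : X) (ν : Measure Y) (φ : X → Y → B) : Prop :=
  ∀ ε : ℝ≥0∞, ε ≠ 0 → ∃ N, IsLabel 𝒩 x₀ N ∧ ∀ x x', N x = N x' → ν {y | φ x y ≠ φ x' y} ≤ ε

variable {𝒩 : Set (Set X)} {x₀ : X} {ν : Measure Y}

theorem IsTame.const (h𝒩 : IsTopBooleanAlgebra 𝒩) (c : Y → B) : IsTame 𝒩 x₀ ν fun _ => c :=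
  fun _ _ => ⟨_, IsLabel.const h𝒩 x₀ 0, by simp⟩

theorem IsTame.comp {φ : X → Y → B} (h : IsTame 𝒩 x₀ ν φ) {𝒩' : Set (Set X')} {x₀' : X'}
    {f : X' → X} (hf : Continuous f) (hm : ∀ C ∈ 𝒩, f ⁻¹' C ∈ 𝒩') (h0 : f x₀' = x₀) :
    IsTame 𝒩' x₀' ν fun x => φ (f x) := by
  intro ε hε
  obtain ⟨N, hN, hφ⟩ := h ε hε
  exact ⟨N ∘ f, hN.comp hf hm h0, fun x x' hx => hφ _ _ hx⟩

variable [AddCommGroup B]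

theorem IsTame.add (h𝒩 : IsTopBooleanAlgebra 𝒩) {φ ψ : X → Y → B} (hφ : IsTame 𝒩 x₀ ν φ)
    (hψ : IsTame 𝒩 x₀ ν ψ) : IsTame 𝒩 x₀ ν fun x y => φ x y + ψ x y := by
  intro ε hε
  obtain ⟨N, hN, h⟩ := hφ (ε / 2) (by simpa using hε)
  obtain ⟨N', hN', h'⟩ := hψ (ε / 2) (by simpa using hε)
  refine ⟨_, hN.pair h𝒩 hN', fun x x' hx => ?_⟩
  obtain ⟨h1, h2⟩ := Nat.pair_eq_pair.1 hx
  calc ν {y | φ x y + ψ x y ≠ φ x' y + ψ x' y}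
      ≤ ν ({y | φ x y ≠ φ x' y} ∪ {y | ψ x y ≠ ψ x' y}) := by
        refine measure_mono fun y hy => ?_
        by_contra hcon
        simp only [Set.mem_union, Set.mem_ofPred_eq, not_or, not_not] at hcon
        exact hy (by rw [hcon.1, hcon.2])
    _ ≤ ε / 2 + ε / 2 := (measure_union_le _ _).trans (add_le_add (h _ _ h1) (h' _ _ h2))
    _ = ε := ENNReal.add_halves ε

theorem IsTame.zsmul {φ : X → Y → B} (hφ : IsTame 𝒩 x₀ ν φ) (n : ℤ) :
    IsTame 𝒩 x₀ ν fun x y => n • φ x y := by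
  intro ε hε
  obtain ⟨N, hN, h⟩ := hφ ε hε
  refine ⟨N, hN, fun x x' hx => (measure_mono ?_).trans (h x x' hx)⟩
  exact fun y (hy : n • φ x y ≠ n • φ x' y) (hy' : φ x y = φ x' y) => hy (by rw [hy'])

theorem IsTame.sum (h𝒩 : IsTopBooleanAlgebra 𝒩) {ι : Type*} {s : Finset ι} {φ : ι → X → Y → B}
    (hφ : ∀ i ∈ s, IsTame 𝒩 x₀ ν (φ i)) : IsTame 𝒩 x₀ ν fun x y => ∑ i ∈ s, φ i x y := by
  classical
  induction s using Finset.induction_on with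
  | empty => simpa using IsTame.const h𝒩 (fun _ => (0 : B))
  | insert a s ha ih =>
    simp only [Finset.sum_insert ha]
    exact IsTame.add h𝒩 (hφ _ (Finset.mem_insert_self _ _))
      (ih fun i hi => hφ i (Finset.mem_insert_of_mem hi))

end Labels

/-! ### The alternating sum of the faces -/

section Coboundary

variable {α B : Type*} [AddCommGroup B]

/-- The alternating sum of the faces, for everywhere defined functions. -/
def coboundary {n : ℕ} (f : (Fin n → α) → B) (y : Fin (n + 1) → α) : B :=
  ∑ i : Fin (n + 1), (-1 : ℤ) ^ (i : ℕ) • f fun j => y (i.succAbove j)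

theorem coboundary_add {n : ℕ} (f g : (Fin n → α) → B) (y : Fin (n + 1) → α) :
    coboundary (fun x => f x + g x) y = coboundary f y + coboundary g y := by
  simp [coboundary, Finset.sum_add_distrib]

theorem coboundary_zsmul {n : ℕ} (k : ℤ) (f : (Fin n → α) → B) (y : Fin (n + 1) → α) :
    coboundary (fun x => k • f x) y = k • coboundary f y := by
  simp only [coboundary, Finset.smul_sum]
  exact Finset.sum_congr rfl fun i _ => smul_comm _ _ _

theorem coboundary_sub {n : ℕ} (f g : (Fin n → α) → B) (y : Fin (n + 1) → α) :
    coboundary (fun x => f x - g x) y = coboundary f y - coboundary g y := by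
  simp [coboundary, smul_sub, Finset.sum_sub_distrib]

theorem coboundary_congr {n : ℕ} {f g : (Fin n → α) → B} {y : Fin (n + 1) → α}
    (h : ∀ i : Fin (n + 1), f (fun j => y (i.succAbove j)) = g fun j => y (i.succAbove j)) :
    coboundary f y = coboundary g y :=
  Finset.sum_congr rfl fun i _ => by rw [h i]

theorem cons_comp_succ_succAbove {n : ℕ} (h : α) (y : Fin (n + 1) → α) (i : Fin (n + 1)) :
    (fun j => (Fin.cons h y : Fin (n + 2) → α) (i.succ.succAbove j)) =
      Fin.cons h fun j => y (i.succAbove j) := by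
  funext j
  refine Fin.cases ?_ (fun j => ?_) j
  · simp
  · simp [Fin.succ_succAbove_succ]

/-- The cone identity: freezing the first variable is a contracting homotopy. For a cocycle the left
side vanishes and `c (h, ·)` is a primitive of `c`. -/
theorem coboundary_cons {n : ℕ} (c : (Fin (n + 1) → α) → B) (h : α) (y : Fin (n + 1) → α) :
    coboundary c (Fin.cons h y) = c y - coboundary (fun w => c (Fin.cons h w)) y := by
  rw [coboundary, Fin.sum_univ_succ, sub_eq_add_neg]
  congr 1
  · simp
  · rw [coboundary, ← Finset.sum_neg_distrib]
    refine Finset.sum_congr rfl fun i _ => ?_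
    rw [cons_comp_succ_succAbove, ← neg_smul]
    congr 1
    simp [pow_succ]

theorem coboundary_coboundary {n : ℕ} (f : (Fin n → α) → B) (y : Fin (n + 2) → α) :
    coboundary (coboundary f) y = 0 := by
  simp only [coboundary, Finset.smul_sum, smul_smul]
  rw [← Fintype.sum_prod_type' (f := fun (i : Fin (n + 2)) (j : Fin (n + 1)) =>
    ((-1 : ℤ) ^ (i : ℕ) * (-1) ^ (j : ℕ)) • f fun k => y (i.succAbove (j.succAbove k)))]
  refine Finset.sum_involution (fun ij _ => (ij.1.succAbove ij.2, ij.2.predAbove ij.1)) ?_ ?_ ?_ ?_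
  · rintro ⟨i, j⟩ -
    dsimp only
    simp only [Fin.succAbove_succAbove_succAbove_predAbove]
    rw [← add_smul]
    convert zero_smul ℤ _
    rw [← pow_add, ← pow_add]
    rcases lt_or_ge j.castSucc i with h | h
    · rw [Fin.succAbove_of_castSucc_lt _ _ h, Fin.predAbove_of_castSucc_lt _ _ h]
      have h' : (j : ℕ) < i := h
      simp only [Fin.val_castSucc, Fin.val_pred]
      rw [show (i : ℕ) + (j : ℕ) = (j : ℕ) + ((i : ℕ) - 1) + 1 by omega, pow_succ]
      ring
    · rw [Fin.succAbove_of_le_castSucc _ _ h, Fin.predAbove_of_le_castSucc _ _ h]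
      have h' : (i : ℕ) ≤ j := h
      simp only [Fin.val_succ, Fin.coe_castPred]
      rw [show (j : ℕ) + 1 + (i : ℕ) = (i : ℕ) + (j : ℕ) + 1 by omega, pow_succ]
      ring
  · rintro ⟨i, j⟩ - -
    simp [Fin.succAbove_ne]
  · simp
  · rintro ⟨i, j⟩ -
    simp [Fin.succAbove_succAbove_predAbove, Fin.predAbove_predAbove_succAbove]

theorem coboundary_comm {β : Type*} {m n : ℕ} (f : (Fin m → α) → (Fin n → β) → B)
    (x : Fin (m + 1) → α) (y : Fin (n + 1) → β) :
    coboundary (fun y => coboundary (fun x => f x y) x) y =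
      coboundary (fun x => coboundary (f x) y) x := by
  simp only [coboundary, Finset.smul_sum]
  rw [Finset.sum_comm]
  exact Finset.sum_congr rfl fun i _ => Finset.sum_congr rfl fun j _ => smul_comm _ _ _

theorem measurable_coboundary {Z : Type*} [MeasurableSpace Z] [MeasurableSpace B] [Countable B]
    [DiscreteMeasurableSpace B] {n : ℕ} {f : Z → (Fin n → α) → B} {y : Z → Fin (n + 1) → α}
    (h : ∀ i : Fin (n + 1), Measurable fun z => f z fun j => y z (i.succAbove j)) :
    Measurable fun z => coboundary (f z) (y z) :=
  Finset.measurable_sum _ fun i _ => (measurable_of_countable fun b : B => _ • b).comp (h i)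

end Coboundary

/-! ### A probability measure equivalent to the product measure -/

section RefMeasure

variable {G : Type*} [MeasurableSpace G]

theorem pi_absolutelyContinuous {μ ν : Measure G} [SigmaFinite μ] [SigmaFinite ν] (h : μ ≪ ν)
    (b : ℕ) : Measure.pi (fun _ : Fin b => μ) ≪ Measure.pi fun _ : Fin b => ν := by
  induction b with
  | zero => rw [Measure.pi_of_empty, Measure.pi_of_empty]
  | succ b ih =>
    have h1 := (measurePreserving_piFinSuccAbove (fun _ : Fin (b + 1) => μ) 0).symm
    have h2 := (measurePreserving_piFinSuccAbove (fun _ : Fin (b + 1) => ν) 0).symm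
    rw [← h1.map_eq, ← h2.map_eq]
    exact (h.prod ih).map (MeasurableEquiv.measurable _)

/-- A probability measure on `G^b` equivalent to the product measure. -/
noncomputable abbrev refMeasure (μ : Measure G) [SFinite μ] (b : ℕ) : Measure (Fin b → G) :=
  Measure.pi fun _ => μ.toFinite

variable (μ : Measure G) [SigmaFinite μ]

theorem refMeasure_absolutelyContinuous (b : ℕ) : refMeasure μ b ≪ powMeasure μ b :=
  pi_absolutelyContinuous (toFinite_absolutelyContinuous μ) b

theorem absolutelyContinuous_refMeasure (b : ℕ) : powMeasure μ b ≪ refMeasure μ b :=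
  pi_absolutelyContinuous (absolutelyContinuous_toFinite μ) b

theorem ae_refMeasure (b : ℕ) : ae (refMeasure μ b) = ae (powMeasure μ b) :=
  le_antisymm (refMeasure_absolutelyContinuous μ b).ae_le (absolutelyContinuous_refMeasure μ b).ae_le

theorem measurePreserving_cons (b : ℕ) :
    MeasurePreserving (fun z : G × (Fin b → G) => (Fin.cons z.1 z.2 : Fin (b + 1) → G))
      (μ.prod (powMeasure μ b)) (powMeasure μ (b + 1)) := by
  convert (measurePreserving_piFinSuccAbove (fun _ : Fin (b + 1) => μ) 0).symm using 1
  funext z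
  exact (Fin.insertNth_zero' z.1 z.2).symm

variable {B : Type*} [AddCommGroup B] [MeasurableSpace B] [Countable B] [DiscreteMeasurableSpace B]

/-- A measurable cocycle on `G^(b+1)` is a coboundary, of a function that is no larger. -/
theorem exists_primitive [NeZero μ] {b : ℕ} {c : (Fin (b + 1) → G) → B} (hc : Measurable c)
    (h0 : ∀ᵐ y ∂refMeasure μ (b + 2), coboundary c y = 0) :
    ∃ e : (Fin b → G) → B, Measurable e ∧ (∀ᵐ y ∂refMeasure μ (b + 1), coboundary e y = c y) ∧
      refMeasure μ b {w | e w ≠ 0} ≤ refMeasure μ (b + 1) {y | c y ≠ 0} := by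
  have h1 := (measurePreserving_cons μ.toFinite (b + 1)).quasiMeasurePreserving.ae h0
  have h2 := Measure.ae_ae_of_ae_prod h1
  have hS : MeasurableSet {y | c y ≠ 0} := (hc (measurableSet_singleton 0)).compl
  have hmp := measurePreserving_cons μ.toFinite b
  have h3 : refMeasure μ (b + 1) {y | c y ≠ 0} =
      ∫⁻ h, refMeasure μ b {w | c (Fin.cons h w) ≠ 0} ∂μ.toFinite := by
    rw [← hmp.measure_preimage hS.nullMeasurableSet, Measure.prod_apply (hmp.measurable hS)]
    rfl
  -- The support measures of the slices `c (h, ·)` average to that of `c` over a probability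
  -- measure, so some `h` off the exceptional null set does not exceed the average.
  obtain ⟨h, hh, hle⟩ := exists_notMem_null_le_lintegral (μ := μ.toFinite)
    (f := fun h => refMeasure μ b {w | c (Fin.cons h w) ≠ 0})
    (measurable_measure_prodMk_left (hmp.measurable hS)).aemeasurable (ae_iff.1 h2)
  refine ⟨fun w => c (Fin.cons h w), ?_, ?_, h3 ▸ hle⟩
  · exact hc.comp (hmp.measurable.comp measurable_prodMk_left)
  · simp only [Set.mem_ofPred_eq, not_not] at hh
    filter_upwards [hh] with y hy
    rw [coboundary_cons] at hy
    exact (sub_eq_zero.1 hy).symm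

theorem ae_face {b : ℕ} {P : (Fin b → G) → Prop} (h : ∀ᵐ w ∂refMeasure μ b, P w) :
    ∀ᵐ y ∂refMeasure μ (b + 1), ∀ i : Fin (b + 1), P fun j => y (i.succAbove j) :=
  ae_all_iff.2 fun i => (quasiMeasurePreserving_face μ.toFinite b i).ae h

theorem IsLabel.measurable {X : Type*} [TopologicalSpace X] [MeasurableSpace X] {𝒩 : Set (Set X)}
    (h : ∀ C ∈ 𝒩, MeasurableSet C) {x₀ : X} {N : X → ℕ} (hN : IsLabel 𝒩 x₀ N) : Measurable N :=
  measurable_to_countable' fun n => h _ (hN.mem n)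

/-- A common refinement of finitely many labellings; it makes the partial sums of the series below
constant on its level sets. -/
theorem exists_isLabel_forall_le {X : Type*} [TopologicalSpace X] {𝒩 : Set (Set X)}
    (h𝒩 : IsTopBooleanAlgebra 𝒩) {x₀ : X} {N : ℕ → X → ℕ} (hN : ∀ n, IsLabel 𝒩 x₀ (N n)) (n : ℕ) :
    ∃ L, IsLabel 𝒩 x₀ L ∧ ∀ x x', L x = L x' → ∀ m ≤ n, N m x = N m x' := by
  induction n with
  | zero => exact ⟨N 0, hN 0, fun x x' h m hm => by rwa [Nat.le_zero.1 hm]⟩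
  | succ n ih =>
    obtain ⟨L, hL, h⟩ := ih
    refine ⟨_, hL.pair h𝒩 (hN (n + 1)), fun x x' hx m hm => ?_⟩
    obtain ⟨h1, h2⟩ := Nat.pair_eq_pair.1 hx
    rcases Nat.le_succ_iff.1 hm with h3 | rfl
    · exact h x x' h1 m h3
    · exact h2

/-- A tame family of measurable cocycles is the coboundary of a tame family. -/
theorem IsTame.exists_primitive [NeZero μ] {X : Type*} [TopologicalSpace X] [MeasurableSpace X]
    {𝒩 : Set (Set X)} (h𝒩 : IsTopBooleanAlgebra 𝒩) (hm : ∀ C ∈ 𝒩, MeasurableSet C) {x₀ : X}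
    {b : ℕ} {φ : X → (Fin (b + 1) → G) → B} (hφ : ∀ x, Measurable (φ x))
    (ht : IsTame 𝒩 x₀ (refMeasure μ (b + 1)) φ)
    (h0 : ∀ x, ∀ᵐ y ∂refMeasure μ (b + 2), coboundary (φ x) y = 0) :
    ∃ ψ : X → (Fin b → G) → B, Measurable (Function.uncurry ψ) ∧
      IsTame 𝒩 x₀ (refMeasure μ b) ψ ∧
      ∀ x, ∀ᵐ y ∂refMeasure μ (b + 1), coboundary (ψ x) y = φ x y := by
  classical
  have hε : ∀ n : ℕ, (2⁻¹ : ℝ≥0∞) ^ n ≠ 0 := fun n => by simp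
  choose N hN hNφ using fun n : ℕ => ht ((2⁻¹ : ℝ≥0∞) ^ n) (hε n)
  -- One representative parameter for each label; for a label that does not occur the claim is
  -- vacuous and any point serves.
  have hr : ∀ (n l : ℕ), ∃ r : X, ∀ x, N n x = l → N n r = l := by
    intro n l
    by_cases h : ∃ x, N n x = l
    · exact ⟨h.choose, fun _ _ => h.choose_spec⟩
    · exact ⟨x₀, fun x hx => (h ⟨x, hx⟩).elim⟩
  choose r hr using hr
  have hclose : ∀ n x, refMeasure μ (b + 1) {y | φ x y ≠ φ (r n (N n x)) y} ≤ (2⁻¹) ^ n :=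
    fun n x => hNφ n _ _ (hr n _ x rfl).symm
  choose e0 he0m he0 _ using fun l =>
    MooreCohomology.exists_primitive μ (hφ (r 0 l)) (h0 (r 0 l))
  have hd : ∀ n l l', ∀ᵐ y ∂refMeasure μ (b + 2),
      coboundary (fun y => φ (r (n + 1) l') y - φ (r n l) y) y = 0 := by
    intro n l l'
    filter_upwards [h0 (r (n + 1) l'), h0 (r n l)] with y h1 h2
    rw [coboundary_sub, h1, h2, sub_zero]
  -- Primitives of the differences of consecutive approximants, for all pairs of labels. They are
  -- small for pairs `N n x`, `N (n + 1) x`, since both approximants are then close to `φ x`;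
  -- countability of the labels gives joint measurability.
  choose e hem he hele using fun n l l' =>
    MooreCohomology.exists_primitive μ ((hφ (r (n + 1) l')).sub (hφ (r n l))) (hd n l l')
  let D : ℕ → X → (Fin b → G) → B := fun n x => e n (N n x) (N (n + 1) x)
  have hD : ∀ n x, refMeasure μ b {w | D n x w ≠ 0} ≤ 2 * (2⁻¹) ^ n := by
    intro n x
    refine (hele n _ _).trans ?_
    calc refMeasure μ (b + 1) {y | φ (r (n + 1) (N (n + 1) x)) y - φ (r n (N n x)) y ≠ 0}
        ≤ refMeasure μ (b + 1) ({y | φ x y ≠ φ (r (n + 1) (N (n + 1) x)) y} ∪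
            {y | φ x y ≠ φ (r n (N n x)) y}) := by
          refine measure_mono fun y hy => ?_
          by_contra hcon
          simp only [Set.mem_union, Set.mem_ofPred_eq, not_or, not_not] at hcon
          exact hy (by rw [← hcon.1, ← hcon.2, sub_self])
      _ ≤ (2⁻¹) ^ (n + 1) + (2⁻¹) ^ n :=
          (measure_union_le _ _).trans (add_le_add (hclose _ _) (hclose _ _))
      _ ≤ (2⁻¹) ^ n + (2⁻¹) ^ n := by
          gcongr ?_ + _
          exact pow_le_pow_right_of_le_one' (by simp) (Nat.le_succ n)
      _ = 2 * (2⁻¹) ^ n := (two_mul _).symm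
  let s : ℕ → X → (Fin b → G) → B := fun n x w => e0 (N 0 x) w + ∑ m ∈ Finset.range n, D m x w
  have hNm : ∀ n, Measurable (N n) := fun n => (hN n).measurable hm
  have hDm : ∀ n, Measurable fun z : X × (Fin b → G) => D n z.1 z.2 := by
    intro n
    have h1 : Measurable fun q : (ℕ × ℕ) × (Fin b → G) => e n q.1.1 q.1.2 q.2 :=
      measurable_from_prod_countable_right fun q => hem n q.1 q.2
    exact h1.comp ((((hNm n).prodMk (hNm (n + 1))).comp measurable_fst).prodMk measurable_snd)
  have hsm : ∀ n, Measurable fun z : X × (Fin b → G) => s n z.1 z.2 := by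
    intro n
    have h1 : Measurable fun q : ℕ × (Fin b → G) => e0 q.1 q.2 :=
      measurable_from_prod_countable_right fun q => he0m q
    exact (h1.comp (((hNm 0).comp measurable_fst).prodMk measurable_snd)).add
      (Finset.measurable_sum _ fun m _ => hDm m)
  have hsδ : ∀ n x, ∀ᵐ y ∂refMeasure μ (b + 1),
      coboundary (s n x) y = φ (r n (N n x)) y := by
    intro n x
    induction n with
    | zero => simpa [s] using he0 (N 0 x)
    | succ n ih =>
      filter_upwards [ih, he n (N n x) (N (n + 1) x)] with y h1 h2
      have : s (n + 1) x = fun w => s n x w + D n x w := by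
        funext w
        simp only [s, Finset.sum_range_succ, add_assoc]
      rw [this, coboundary_add, h1, h2, Pi.sub_apply]
      abel
  -- the series is eventually constant off a null set
  let E : ℕ → X × (Fin b → G) → Prop := fun n z => ∀ m, n ≤ m → D m z.1 z.2 = 0
  have hEm : ∀ n, MeasurableSet {z | E n z} := by
    intro n
    simp only [E, Set.ofPred_forall]
    exact MeasurableSet.iInter fun m => MeasurableSet.iInter fun _ =>
      hDm m (measurableSet_singleton 0)
  have hse : ∀ n n' z, n ≤ n' → E n z → s n' z.1 z.2 = s n z.1 z.2 := by
    intro n n' z hn hz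
    simp only [s]
    congr 1
    refine (Finset.sum_subset (Finset.range_mono hn) fun m _ hm => hz m ?_).symm
    simpa using hm
  have hex : ∀ z, ∃ n, E n z ∨ ∀ k, ¬E k z := by
    intro z
    by_cases h : ∃ n, E n z
    · exact ⟨h.choose, Or.inl h.choose_spec⟩
    · exact ⟨0, Or.inr (not_exists.1 h)⟩
  -- The sum of the series: the partial sum at the first index from which all terms vanish, and `0`
  -- where there is no such index.
  let ψ' : X × (Fin b → G) → B := fun z =>
    (fun n z => if E n z then s n z.1 z.2 else 0) (Nat.find (hex z)) z
  have hψ' : Measurable ψ' := by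
    refine Measurable.find (f := fun n z => if E n z then s n z.1 z.2 else 0)
      (fun n => Measurable.ite (hEm n) (hsm n) measurable_const) (fun n => ?_) hex
    have h1 : MeasurableSet {z | ∀ k, ¬E k z} := by
      rw [Set.ofPred_forall]
      exact MeasurableSet.iInter fun k => (hEm k).compl
    exact (hEm n).union h1
  have hψs : ∀ n z, E n z → ψ' z = s n z.1 z.2 := by
    intro n z hz
    have h1 : E (Nat.find (hex z)) z := by
      rcases Nat.find_spec (hex z) with h | h
      · exact h
      · exact (h n hz).elim
    have h2 : Nat.find (hex z) ≤ n := Nat.find_min' (hex z) (Or.inl hz)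
    simp only [ψ', if_pos h1]
    exact (hse _ _ z h2 h1).symm
  have hEtail : ∀ n x, refMeasure μ b {w | ¬E n (x, w)} ≤ 4 * (2⁻¹) ^ n := by
    intro n x
    calc refMeasure μ b {w | ¬E n (x, w)}
        ≤ refMeasure μ b (⋃ m, {w | D (n + m) x w ≠ 0}) := by
          refine measure_mono fun w hw => ?_
          simp only [E, Set.mem_ofPred_eq, not_forall] at hw
          obtain ⟨m, hm, hw⟩ := hw
          refine Set.mem_iUnion.2 ⟨m - n, ?_⟩
          rwa [Nat.add_sub_cancel' hm]
      _ ≤ ∑' m, refMeasure μ b {w | D (n + m) x w ≠ 0} := measure_iUnion_le _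
      _ ≤ ∑' m, 2 * (2⁻¹) ^ n * (2⁻¹) ^ m := by
          refine ENNReal.tsum_le_tsum fun m => (hD _ x).trans_eq ?_
          rw [pow_add, mul_assoc]
      _ = 4 * (2⁻¹) ^ n := by
          rw [ENNReal.tsum_mul_left, ENNReal.tsum_geometric, ENNReal.one_sub_inv_two, inv_inv,
            mul_right_comm]
          norm_num
  refine ⟨fun x w => ψ' (x, w), hψ', fun ε hε => ?_, fun x => ?_⟩
  -- The `n`-th partial sum depends only on the labels `N 0, …, N n`; two tails of measure at most
  -- `4 * 2⁻¹ ^ n` account for the constant `8`.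
  · obtain ⟨n, hn⟩ : ∃ n : ℕ, 8 * (2⁻¹ : ℝ≥0∞) ^ n ≤ ε := by
      have h1 : Tendsto (fun n : ℕ => 8 * (2⁻¹ : ℝ≥0∞) ^ n) atTop (𝓝 (8 * 0)) :=
        ENNReal.Tendsto.const_mul (ENNReal.tendsto_pow_atTop_nhds_zero_of_lt_one (by simp))
          (Or.inr (by simp))
      rw [mul_zero] at h1
      exact (h1.eventually (ge_mem_nhds (pos_iff_ne_zero.2 hε))).exists
    obtain ⟨L, hL, hLN⟩ := exists_isLabel_forall_le h𝒩 hN n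
    refine ⟨L, hL, fun x x' hx => ?_⟩
    have h1 := hLN x x' hx
    have h2 : s n x = s n x' := by
      funext w
      simp only [s, D]
      rw [h1 0 (Nat.zero_le _)]
      congr 1
      refine Finset.sum_congr rfl fun m hm => ?_
      have hm' := Finset.mem_range.1 hm
      rw [h1 m hm'.le, h1 (m + 1) hm']
    calc refMeasure μ b {w | ψ' (x, w) ≠ ψ' (x', w)}
        ≤ refMeasure μ b ({w | ¬E n (x, w)} ∪ {w | ¬E n (x', w)}) := by
          refine measure_mono fun w hw => ?_
          by_contra hcon
          simp only [Set.mem_union, Set.mem_ofPred_eq, not_or, not_not] at hcon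
          exact hw (by rw [hψs n _ hcon.1, hψs n _ hcon.2, h2])
      _ ≤ 4 * (2⁻¹) ^ n + 4 * (2⁻¹) ^ n :=
          (measure_union_le _ _).trans (add_le_add (hEtail _ _) (hEtail _ _))
      _ = 8 * (2⁻¹) ^ n := by rw [← add_mul]; norm_num
      _ ≤ ε := hn
  · have hsum : ∑' n : ℕ, (2⁻¹ : ℝ≥0∞) ^ n ≠ ∞ := by
      rw [ENNReal.tsum_geometric, ENNReal.one_sub_inv_two, inv_inv]; simp
    have hE : ∀ᵐ w ∂refMeasure μ b, ∃ n, E n (x, w) := by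
      have h1 : ∑' n, refMeasure μ b {w | D n x w ≠ 0} ≠ ∞ := by
        refine ne_top_of_le_ne_top ?_ (ENNReal.tsum_le_tsum fun n => hD n x)
        rw [ENNReal.tsum_mul_left]
        exact ENNReal.mul_ne_top (by simp) hsum
      filter_upwards [ae_eventually_notMem h1] with w hw
      obtain ⟨n, hn⟩ := eventually_atTop.1 hw
      exact ⟨n, fun m hm => not_not.1 (hn m hm)⟩
    have hc : ∀ᵐ y ∂refMeasure μ (b + 1), ∀ᶠ n in atTop, φ x y = φ (r n (N n x)) y := by
      have h1 : ∑' n, refMeasure μ (b + 1) {y | φ x y ≠ φ (r n (N n x)) y} ≠ ∞ :=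
        ne_top_of_le_ne_top hsum (ENNReal.tsum_le_tsum fun n => hclose n x)
      filter_upwards [ae_eventually_notMem h1] with y hy
      filter_upwards [hy] with n hn using not_not.1 hn
    filter_upwards [ae_face μ hE, hc, ae_all_iff.2 fun n => hsδ n x] with y h1 h2 h3
    choose n hn using h1
    -- An index past the stabilisation of the series at every face of `y`, at which the approximant
    -- also equals `φ x y`.
    obtain ⟨k, hk, hk'⟩ := (h2.and (eventually_ge_atTop (Finset.univ.sup n))).exists
    rw [hk, ← h3 k]
    refine coboundary_congr fun i => hψs k _ fun m hm => hn i m (le_trans ?_ (hk'.trans hm))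
    exact Finset.le_sup (f := n) (Finset.mem_univ i)

end RefMeasure

/-! ### Continuity of translations -/

/-- The density of `ν` with respect to `l` is integrable, so its integral over sets of small
`l`-measure is uniformly small. -/
theorem exists_forall_measure_lt_of_absolutelyContinuous {Z : Type*} [MeasurableSpace Z]
    {ν l : Measure Z} [IsFiniteMeasure ν] [SigmaFinite l] (h : ν ≪ l) {ε : ℝ≥0∞} (hε : ε ≠ 0) :
    ∃ δ : ℝ≥0∞, δ ≠ 0 ∧ ∀ s, l s < δ → ν s < ε := by
  have h1 : ∫⁻ x, ν.rnDeriv l x ∂l ≠ ∞ := (Measure.lintegral_rnDeriv_lt_top ν l).ne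
  obtain ⟨δ, hδ, H⟩ := exists_pos_setLIntegral_lt_of_measure_lt h1 hε
  refine ⟨δ, hδ.ne', fun s hs => ?_⟩
  rw [← Measure.withDensity_rnDeriv_eq ν l h, withDensity_apply' _ s]
  exact H s hs

section Translation

variable {G : Type*} [Group G] [TopologicalSpace G] [IsTopologicalGroup G] [LocallyCompactSpace G]
  [SecondCountableTopology G] [T2Space G] [MeasurableSpace G] [BorelSpace G] (μ : Measure G)
  [μ.IsHaarMeasure]

theorem exists_isCompact_refMeasure_compl_lt (b : ℕ) {ε : ℝ≥0∞} (hε : ε ≠ 0) :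
    ∃ K : Set (Fin b → G), IsCompact K ∧ refMeasure μ b Kᶜ < ε := by
  obtain ⟨K, -, hK, h⟩ := (MeasurableSet.univ (α := Fin b → G)).exists_isCompact_sdiff_lt
    (measure_ne_top (refMeasure μ b) _) hε
  exact ⟨K, hK, by rwa [Set.compl_eq_univ_sdiff]⟩

theorem continuous_diag_smul (b : ℕ) :
    Continuous fun z : G × (Fin b → G) => fun i => z.1⁻¹ * z.2 i := by fun_prop

/-- Translation by group elements in a neighbourhood is uniformly absolutely continuous. -/
theorem exists_eventually_refMeasure_translate_le (b : ℕ) (g₀ : G) {ε : ℝ≥0∞} (hε : ε ≠ 0) :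
    ∃ δ : ℝ≥0∞, δ ≠ 0 ∧ ∀ᶠ g in 𝓝 g₀, ∀ E, MeasurableSet E → refMeasure μ b E ≤ δ →
      refMeasure μ b {y | (fun i => g⁻¹ * y i) ∈ E} ≤ ε := by
  have hε2 : ε / 2 ≠ 0 := by simpa using hε
  obtain ⟨K, hK, hKε⟩ := exists_isCompact_refMeasure_compl_lt μ b hε2
  obtain ⟨V, hV, hVg⟩ := exists_compact_mem_nhds g₀
  -- The reference measure is not invariant, so the estimate passes through Haar measure. The
  -- compact `K'` contains every translate `g⁻¹K` with `g ∈ V` and has finite Haar measure, which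
  -- makes absolute continuity quantitative on it.
  have hK' := (hV.prod hK).image (continuous_diag_smul (G := G) b)
  set K' := (fun z : G × (Fin b → G) => fun i => z.1⁻¹ * z.2 i) '' (V ×ˢ K)
  obtain ⟨δ₁, hδ₁, h1⟩ := exists_forall_measure_lt_of_absolutelyContinuous
    (refMeasure_absolutelyContinuous μ b) hε2
  have : IsFiniteMeasure ((powMeasure μ b).restrict K') := ⟨by
    rw [Measure.restrict_apply_univ]; exact hK'.measure_lt_top⟩
  obtain ⟨δ, hδ, h2⟩ := exists_forall_measure_lt_of_absolutelyContinuous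
    (Measure.absolutelyContinuous_of_le Measure.restrict_le_self |>.trans
      (absolutelyContinuous_refMeasure μ b) : (powMeasure μ b).restrict K' ≪ _) hδ₁
  obtain ⟨δ', hδ', hδδ⟩ := exists_between (pos_iff_ne_zero.2 hδ)
  refine ⟨δ', hδ'.ne', ?_⟩
  filter_upwards [hVg] with g hg E hE hEδ
  have h3 := h2 E (hEδ.trans_lt hδδ)
  rw [Measure.restrict_apply hE] at h3
  have h4 := (measurePreserving_diag μ b g⁻¹).measure_preimage
    (hE.inter hK'.measurableSet).nullMeasurableSet
  calc refMeasure μ b {y | (fun i => g⁻¹ * y i) ∈ E}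
      ≤ refMeasure μ b (Kᶜ ∪ (fun y i => g⁻¹ * y i) ⁻¹' (E ∩ K')) := by
        refine measure_mono fun y hy => ?_
        by_cases hyK : y ∈ K
        · exact Or.inr ⟨hy, (g, y), ⟨hg, hyK⟩, rfl⟩
        · exact Or.inl hyK
    _ ≤ ε / 2 + ε / 2 := (measure_union_le _ _).trans
        (add_le_add hKε.le (h1 _ (h4.trans_lt h3)).le)
    _ = ε := ENNReal.add_halves ε

/-- Up to a small error only points of a compact `K` matter, and there `E` may be replaced by its
part in `g₀⁻¹K`. That part has finite Haar measure, so the symmetric differences of its translates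
tend to zero in Haar measure. -/
theorem eventually_refMeasure_translate_diff_le (b : ℕ) (g₀ : G) {E : Set (Fin b → G)}
    (hE : MeasurableSet E) {ε : ℝ≥0∞} (hε : ε ≠ 0) :
    ∀ᶠ g in 𝓝 g₀, refMeasure μ b
      {y | (fun i => g₀⁻¹ * y i) ∈ E ∧ (fun i => g⁻¹ * y i) ∉ E} ≤ ε := by
  have hε2 : ε / 2 ≠ 0 := by simpa using hε
  obtain ⟨K, hK, hKε⟩ := exists_isCompact_refMeasure_compl_lt μ b hε2
  have hK0 : IsCompact ((fun (y : Fin b → G) i => g₀⁻¹ * y i) '' K) :=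
    hK.image (by fun_prop)
  set K0 := (fun (y : Fin b → G) i => g₀⁻¹ * y i) '' K
  obtain ⟨δ, hδ, h1⟩ := exists_forall_measure_lt_of_absolutelyContinuous
    (refMeasure_absolutelyContinuous μ b) hε2
  let f : G → C(Fin b → G, Fin b → G) := fun g => ⟨fun y i => g⁻¹ * y i, by fun_prop⟩
  have hf : Continuous f :=
    ContinuousMap.continuous_of_continuous_uncurry _ (continuous_diag_smul b)
  have hfm : ∀ g, MeasurePreserving (f g) (powMeasure μ b) (powMeasure μ b) := fun g =>
    measurePreserving_diag μ b g⁻¹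
  have hlt : powMeasure μ b (E ∩ K0) ≠ ∞ :=
    ((measure_mono Set.inter_subset_right).trans_lt hK0.measure_lt_top).ne
  have h2 := tendsto_measure_symmDiff_preimage_nhds_zero (hf.tendsto g₀) (.of_forall hfm) (hfm g₀)
    (hE.inter hK0.measurableSet).nullMeasurableSet hlt
  filter_upwards [h2.eventually (gt_mem_nhds (pos_iff_ne_zero.2 hδ))] with g hg
  calc refMeasure μ b {y | (fun i => g₀⁻¹ * y i) ∈ E ∧ (fun i => g⁻¹ * y i) ∉ E}
      ≤ refMeasure μ b (Kᶜ ∪ symmDiff (f g ⁻¹' (E ∩ K0)) (f g₀ ⁻¹' (E ∩ K0))) := by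
        refine measure_mono fun y hy => ?_
        by_cases hyK : y ∈ K
        · exact Or.inr (Or.inr ⟨⟨hy.1, y, hyK, rfl⟩, fun h => hy.2 h.1⟩)
        · exact Or.inl hyK
    _ ≤ ε / 2 + ε / 2 := (measure_union_le _ _).trans (add_le_add hKε.le (h1 _ hg).le)
    _ = ε := ENNReal.add_halves ε

variable {B : Type*} [AddCommGroup B] [Countable B] [TopologicalSpace B] [DiscreteTopology B]
  [MeasurableSpace B] [DiscreteMeasurableSpace B] [DistribMulAction G B] [ContinuousSMul G B]

theorem eventually_smul_eq (g₀ : G) (a : B) : ∀ᶠ g in 𝓝 g₀, g • a = g₀ • a := by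
  have h : ContinuousAt (fun g : G => g • a) g₀ := by fun_prop
  have := h.eventually (mem_nhds_discrete.2 (Set.mem_singleton (g₀ • a)))
  exact this

/-- The translates of a measurable function depend continuously, in measure, on the translation. -/
theorem eventually_refMeasure_smul_ne_le (b : ℕ) (g₀ : G) {c : (Fin b → G) → B} (hc : Measurable c)
    {ε : ℝ≥0∞} (hε : ε ≠ 0) :
    ∀ᶠ g in 𝓝 g₀, refMeasure μ b
      {y | g • c (fun i => g⁻¹ * y i) ≠ g₀ • c (fun i => g₀⁻¹ * y i)} ≤ ε := by
  have hε2 : ε / 2 ≠ 0 := by simpa using hε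
  have hu : Measurable fun y : Fin b → G => c fun i => g₀⁻¹ * y i :=
    hc.comp (measurePreserving_diag μ b g₀⁻¹).measurable
  -- By tightness all but finitely many values can be discarded; on the rest `g • a = g₀ • a` near
  -- `g₀`.
  obtain ⟨F, hF, hFε⟩ : ∃ F : Set B, F.Finite ∧
      refMeasure μ b {y | c (fun i => g₀⁻¹ * y i) ∉ F} < ε / 2 := by
    have : BorelSpace B := ⟨by
      rw [borel_eq_top_of_discrete]
      exact top_le_iff.1 fun s _ => MeasurableSet.of_discrete⟩
    obtain ⟨F, -, hF, h⟩ := (MeasurableSet.univ (α := B)).exists_isCompact_sdiff_lt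
      (measure_ne_top ((refMeasure μ b).map fun y => c fun i => g₀⁻¹ * y i) _) hε2
    refine ⟨F, hF.finite_of_discrete, ?_⟩
    rwa [Measure.map_apply hu MeasurableSet.of_discrete, ← Set.compl_eq_univ_sdiff] at h
  -- Half the tolerance is shared among the values kept; if there are none, `η` is infinite, which
  -- does no harm.
  obtain ⟨η, hη, hηF⟩ : ∃ η : ℝ≥0∞, η ≠ 0 ∧ (hF.toFinset.card : ℝ≥0∞) * η ≤ ε / 2 := by
    refine ⟨ε / 2 / hF.toFinset.card, ENNReal.div_ne_zero.2 ⟨hε2, by simp⟩, ENNReal.mul_div_le⟩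
  have h1 : ∀ᶠ g in 𝓝 g₀, ∀ a ∈ hF.toFinset, g • a = g₀ • a ∧ refMeasure μ b
      {y | (fun i => g₀⁻¹ * y i) ∈ c ⁻¹' {a} ∧ (fun i => g⁻¹ * y i) ∉ c ⁻¹' {a}} ≤ η :=
    (Finset.eventually_all _).2 fun a _ => (eventually_smul_eq g₀ a).and
      (eventually_refMeasure_translate_diff_le μ b g₀ (hc (measurableSet_singleton a)) hη)
  filter_upwards [h1] with g hg
  calc refMeasure μ b {y | g • c (fun i => g⁻¹ * y i) ≠ g₀ • c (fun i => g₀⁻¹ * y i)}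
      ≤ refMeasure μ b ({y | c (fun i => g₀⁻¹ * y i) ∉ F} ∪ ⋃ a ∈ hF.toFinset,
          {y | (fun i => g₀⁻¹ * y i) ∈ c ⁻¹' {a} ∧ (fun i => g⁻¹ * y i) ∉ c ⁻¹' {a}}) := by
        refine measure_mono fun y hy => ?_
        by_cases hyF : c (fun i => g₀⁻¹ * y i) ∈ F
        · refine Or.inr (Set.mem_biUnion (hF.mem_toFinset.2 hyF) ⟨rfl, fun h => hy ?_⟩)
          have h' : c (fun i => g⁻¹ * y i) = c (fun i => g₀⁻¹ * y i) := h
          rw [h', (hg _ (hF.mem_toFinset.2 hyF)).1]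
        · exact Or.inl hyF
    _ ≤ ε / 2 + ∑ a ∈ hF.toFinset, η :=
        (measure_union_le _ _).trans (add_le_add hFε.le ((measure_biUnion_finset_le _ _).trans
          (Finset.sum_le_sum fun a ha => (hg a ha).2)))
    _ ≤ ε / 2 + ε / 2 := by rw [Finset.sum_const, nsmul_eq_mul]; gcongr
    _ = ε := ENNReal.add_halves ε

/-! ### Regular families -/

/-- A system of Boolean algebras of Borel sets with null frontier in the powers of `G`, stable under
the structure maps of the homogeneous bar resolution. -/
structure IsTameSystem (𝒩 : ∀ q : ℕ, Set (Set (Fin q → G))) : Prop where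
  alg : ∀ q, IsTopBooleanAlgebra (𝒩 q)
  measurableSet : ∀ q, ∀ C ∈ 𝒩 q, MeasurableSet C
  null_frontier : ∀ q, ∀ C ∈ 𝒩 q, powMeasure μ q (frontier C) = 0
  face : ∀ q (i : Fin (q + 1)), ∀ C ∈ 𝒩 q,
    (fun (x : Fin (q + 1) → G) j => x (i.succAbove j)) ⁻¹' C ∈ 𝒩 (q + 1)
  quot : ∀ q, ∀ C ∈ 𝒩 q, (fun (x : Fin (q + 1) → G) (j : Fin q) => (x 0)⁻¹ * x j.succ) ⁻¹' C ∈ 𝒩 (q + 1)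
  mul_right : ∀ q (h : G), ∀ C ∈ 𝒩 q, (fun (x : Fin q → G) j => x j * h) ⁻¹' C ∈ 𝒩 q

/-- The equivariant extension of a family given on the slice of the tuples starting with `1`. -/
def homogenize {k b : ℕ} (t : (Fin k → G) → (Fin b → G) → B) (x : Fin (k + 1) → G)
    (y : Fin b → G) : B :=
  x 0 • t (fun j => (x 0)⁻¹ * x j.succ) fun j => (x 0)⁻¹ * y j

variable {μ}

theorem IsTame.homogenize {𝒩 : ∀ q : ℕ, Set (Set (Fin q → G))} (h𝒩 : IsTameSystem μ 𝒩) {k b : ℕ}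
    {t : (Fin k → G) → (Fin b → G) → B} (hm : ∀ u, Measurable (t u))
    (ht : IsTame (𝒩 k) 1 (refMeasure μ b) t) :
    IsTame (𝒩 (k + 1)) 1 (refMeasure μ b) (homogenize t) := by
  intro ε hε
  have hε4 : ε / 4 ≠ 0 := by simpa using hε
  refine exists_isLabel_of_local (h𝒩.alg _) 1
    (R := fun x x' => refMeasure μ b {y | MooreCohomology.homogenize t x y ≠
      MooreCohomology.homogenize t x' y} ≤ ε) fun x => ?_
  obtain ⟨δ, hδ, hg⟩ := exists_eventually_refMeasure_translate_le μ b (x 0) hε4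
  -- The tolerance `δ` works only for translations by elements near `x 0`; this is why the labelling
  -- is built locally and then glued.
  obtain ⟨N, hN, hNt⟩ := ht δ hδ
  have hcont : Continuous fun (x : Fin (k + 1) → G) (j : Fin k) => (x 0)⁻¹ * x j.succ := by fun_prop
  have hN' := hN.comp (x₀' := 1) hcont (h𝒩.quot k) (by ext j; simp)
  obtain ⟨S, hS, hxS⟩ := hN'.locFin x
  have hr : ∀ l : ℕ, ∃ r : Fin k → G, ∀ u, N u = l → N r = l := by
    intro l
    by_cases h : ∃ u, N u = l
    · exact ⟨h.choose, fun _ _ => h.choose_spec⟩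
    · exact ⟨1, fun x hx => (h ⟨x, hx⟩).elim⟩
  choose r hr using hr
  have h1 : ∀ᶠ g in 𝓝 (x 0), ∀ l ∈ S, refMeasure μ b
      {y | g • t (r l) (fun i => g⁻¹ * y i) ≠ x 0 • t (r l) (fun i => (x 0)⁻¹ * y i)} ≤ ε / 4 :=
    hS.eventually_all.2 fun l _ => eventually_refMeasure_smul_ne_le μ b (x 0) (hm (r l)) hε4
  have h0 : Tendsto (fun z : Fin (k + 1) → G => z 0) (𝓝 x) (𝓝 (x 0)) :=
    (continuous_apply 0).continuousAt
  refine ⟨_, (h0.eventually hg).and ((h0.eventually h1).and hxS), _, hN', ?_⟩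
  rintro z ⟨hz1, hz2, hz3⟩ z' ⟨hz1', hz2', hz3'⟩ hzz
  set l := (N ∘ fun (x : Fin (k + 1) → G) (j : Fin k) => (x 0)⁻¹ * x j.succ) z with hl
  have key : ∀ w : Fin (k + 1) → G, N (fun j => (w 0)⁻¹ * w j.succ) = l →
      (∀ E, MeasurableSet E → refMeasure μ b E ≤ δ →
        refMeasure μ b {y | (fun i => (w 0)⁻¹ * y i) ∈ E} ≤ ε / 4) →
      refMeasure μ b {y | (fun i => (w 0)⁻¹ * y i) ∈
        {v | t (fun j => (w 0)⁻¹ * w j.succ) v ≠ t (r l) v}} ≤ ε / 4 := by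
    intro w hw hE
    refine hE _ (measurableSet_eq_fun (hm _) (hm _)).compl (hNt _ _ ?_)
    rw [hw, hr l _ hw]
  have hA := key z rfl hz1
  have hA' := key z' hzz.symm hz1'
  have hC := hz2 l hz3
  have hC' := hz2' l hz3
  calc refMeasure μ b {y | MooreCohomology.homogenize t z y ≠ MooreCohomology.homogenize t z' y}
      ≤ refMeasure μ b (({y | (fun i => (z 0)⁻¹ * y i) ∈
            {v | t (fun j => (z 0)⁻¹ * z j.succ) v ≠ t (r l) v}} ∪
          {y | z 0 • t (r l) (fun i => (z 0)⁻¹ * y i) ≠ x 0 • t (r l) (fun i => (x 0)⁻¹ * y i)}) ∪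
          ({y | (fun i => (z' 0)⁻¹ * y i) ∈
            {v | t (fun j => (z' 0)⁻¹ * z' j.succ) v ≠ t (r l) v}} ∪
          {y | z' 0 • t (r l) (fun i => (z' 0)⁻¹ * y i) ≠
            x 0 • t (r l) (fun i => (x 0)⁻¹ * y i)})) := by
        refine measure_mono fun y hy => ?_
        by_contra hcon
        simp only [Set.mem_union, Set.mem_ofPred_eq, not_or, not_not] at hcon
        obtain ⟨⟨h1, h2⟩, h3, h4⟩ := hcon
        refine hy ?_
        simp only [MooreCohomology.homogenize]
        rw [h1, h2, h3, h4]
    _ ≤ (ε / 4 + ε / 4) + (ε / 4 + ε / 4) :=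
        (measure_union_le _ _).trans (add_le_add ((measure_union_le _ _).trans (add_le_add hA hC))
          ((measure_union_le _ _).trans (add_le_add hA' hC')))
    _ = ε := by
        rw [show ε / 4 = ε / 2 / 2 by rw [div_eq_mul_inv, div_eq_mul_inv, div_eq_mul_inv, mul_assoc,
          ← ENNReal.mul_inv (by simp) (by simp)]; norm_num]
        rw [ENNReal.add_halves, ENNReal.add_halves]

end Translation

section Regular

variable {G : Type*} [Group G] [TopologicalSpace G] [IsTopologicalGroup G] [LocallyCompactSpace G]
  [SecondCountableTopology G] [T2Space G] [MeasurableSpace G] [BorelSpace G] {μ : Measure G}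
  [μ.IsHaarMeasure]

variable {B : Type*} [AddCommGroup B] [Countable B] [TopologicalSpace B] [DiscreteTopology B]
  [MeasurableSpace B] [DiscreteMeasurableSpace B] [DistribMulAction G B] [ContinuousSMul G B]

theorem measurable_smul_of_discrete : Measurable fun z : G × B => z.1 • z.2 := by
  refine measurable_from_prod_countable_left fun a => ?_
  refine measurable_to_countable' fun a' => ?_
  exact ((isOpen_discrete {a'}).preimage
    (by fun_prop : Continuous fun g : G => g • a)).measurableSet

variable (μ) in
/-- An equivariant and jointly measurable function that is tame in the first group of variables,
both on `G^(k+1)` and on the slice of tuples that start with `1`. -/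
structure IsRegular (𝒩 : ∀ q : ℕ, Set (Set (Fin q → G))) {k b : ℕ}
    (τ : (Fin (k + 1) → G) → (Fin b → G) → B) : Prop where
  equivariant : ∀ g x y, τ (fun i => g * x i) (fun i => g * y i) = g • τ x y
  measurable : Measurable (Function.uncurry τ)
  tame : IsTame (𝒩 (k + 1)) 1 (refMeasure μ b) τ
  tame_slice : IsTame (𝒩 k) 1 (refMeasure μ b) fun u => τ (Fin.cons 1 u)

variable {𝒩 : ∀ q : ℕ, Set (Set (Fin q → G))}

theorem isRegular_homogenize (h𝒩 : IsTameSystem μ 𝒩) {k b : ℕ}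
    {t : (Fin k → G) → (Fin b → G) → B} (hm : Measurable (Function.uncurry t))
    (ht : IsTame (𝒩 k) 1 (refMeasure μ b) t) : IsRegular μ 𝒩 (homogenize t) where
  equivariant g x y := by
    simp only [homogenize, mul_inv_rev, mul_smul, mul_assoc, inv_mul_cancel_left]
  measurable := by
    have h1 : Measurable fun z : (Fin (k + 1) → G) × (Fin b → G) =>
        ((fun j : Fin k => (z.1 0)⁻¹ * z.1 j.succ), fun j => (z.1 0)⁻¹ * z.2 j) := by fun_prop
    have h2 : Measurable fun z : (Fin (k + 1) → G) × (Fin b → G) => z.1 0 := by fun_prop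
    exact measurable_smul_of_discrete.comp (h2.prodMk (hm.comp h1))
  tame := ht.homogenize h𝒩 fun u => hm.comp measurable_prodMk_left
  tame_slice := by
    convert ht using 2 with u
    funext y
    simp [homogenize]

theorem isTame_coboundary (h𝒩 : IsTameSystem μ 𝒩) {n b : ℕ} {τ : (Fin n → G) → (Fin b → G) → B}
    (h : IsTame (𝒩 n) 1 (refMeasure μ b) τ) :
    IsTame (𝒩 (n + 1)) 1 (refMeasure μ b) fun x y => coboundary (fun x => τ x y) x := by
  refine IsTame.sum (h𝒩.alg _) fun i _ => IsTame.zsmul ?_ _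
  exact h.comp (by fun_prop) (h𝒩.face n i) rfl

namespace IsRegular

variable {k b : ℕ} {τ : (Fin (k + 1) → G) → (Fin b → G) → B}

theorem zsmul (h : IsRegular μ 𝒩 τ) (n : ℤ) : IsRegular μ 𝒩 fun x y => n • τ x y where
  equivariant g x y := by rw [h.equivariant, smul_comm]
  measurable := (measurable_of_countable fun b : B => n • b).comp h.measurable
  tame := h.tame.zsmul n
  tame_slice := h.tame_slice.zsmul n

theorem coboundary (h𝒩 : IsTameSystem μ 𝒩) (h : IsRegular μ 𝒩 τ) :
    IsRegular μ 𝒩 fun (x : Fin (k + 1 + 1) → G) y => coboundary (fun x => τ x y) x where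
  equivariant g x y := by
    simp only [MooreCohomology.coboundary, Finset.smul_sum]
    exact Finset.sum_congr rfl fun i _ => by rw [h.equivariant, smul_comm]
  measurable := by
    refine measurable_coboundary (f := fun (z : (Fin (k + 1 + 1) → G) × (Fin b → G)) x => τ x z.2)
      (y := fun z => z.1) fun i => ?_
    have h1 : Measurable fun z : (Fin (k + 1 + 1) → G) × (Fin b → G) =>
      ((fun j => z.1 (i.succAbove j)), z.2) := by fun_prop
    exact h.measurable.comp h1
  tame := isTame_coboundary h𝒩 h.tame
  tame_slice := by
    -- By the cone identity the slice of `∂τ` is `τ` minus the coboundary of its slice, so both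
    -- tameness conditions are used. Tameness on the slice is carried separately because sets with
    -- null frontier need not meet the slice in sets with null frontier.
    have h1 := h.tame.add (h𝒩.alg _) ((isTame_coboundary h𝒩 h.tame_slice).zsmul (-1))
    convert h1 using 2 with u
    funext y
    rw [coboundary_cons, neg_one_smul, sub_eq_add_neg]

/-- A primitive chosen for each `x` separately would not be equivariant. It is therefore chosen on
the slice `x 0 = 1`, where equivariance imposes no condition, and then homogenized. -/
theorem exists_primitive (h𝒩 : IsTameSystem μ 𝒩) {φ : (Fin (k + 1) → G) → (Fin (b + 1) → G) → B}
    (h : IsRegular μ 𝒩 φ)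
    (h0 : ∀ x, ∀ᵐ y ∂powMeasure μ (b + 2), MooreCohomology.coboundary (φ x) y = 0) :
    ∃ τ : (Fin (k + 1) → G) → (Fin b → G) → B, IsRegular μ 𝒩 τ ∧
      ∀ x, ∀ᵐ y ∂powMeasure μ (b + 1), MooreCohomology.coboundary (τ x) y = φ x y := by
  have hm : ∀ u : Fin k → G, Measurable (φ (Fin.cons 1 u)) := fun u =>
    h.measurable.comp measurable_prodMk_left
  obtain ⟨ψ, hψm, hψt, hψ⟩ := h.tame_slice.exists_primitive μ (h𝒩.alg k) (h𝒩.measurableSet k) hm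
    fun u => (refMeasure_absolutelyContinuous μ _).ae_le (h0 _)
  refine ⟨homogenize ψ, isRegular_homogenize h𝒩 hψm hψt, fun x => ?_⟩
  have h1 := hψ fun j => (x 0)⁻¹ * x j.succ
  rw [ae_refMeasure] at h1
  filter_upwards [(measurePreserving_diag μ (b + 1) (x 0)⁻¹).quasiMeasurePreserving.ae h1] with y hy
  have h2 : MooreCohomology.coboundary (homogenize ψ x) y = x 0 •
      MooreCohomology.coboundary (ψ fun j => (x 0)⁻¹ * x j.succ) (fun i => (x 0)⁻¹ * y i) := by
    simp only [MooreCohomology.coboundary, Finset.smul_sum]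
    exact Finset.sum_congr rfl fun i _ => smul_comm _ _ _
  rw [h2, hy, ← h.equivariant]
  congr 1
  · funext i
    refine Fin.cases ?_ (fun i => ?_) i <;> simp
  · simp

end IsRegular

/-! ### Comparison of cocycles on mixed tuples -/

/-- The function of `z : G^(p+1)` obtained by filling the first `k+1` coordinates of `z`, translated
on the right by `h`, into the first variables of `φ`, and the coordinates of `z` from the `k`-th on
into the remaining ones. -/
def spread (p : ℕ) {k b : ℕ} (h : G) (φ : (Fin (k + 1) → G) → (Fin (b + 1) → G) → B)
    (z : Fin (p + 1) → G) : B :=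
  φ (fun i => z (Fin.ofNat (p + 1) i) * h) fun j => z (Fin.ofNat (p + 1) (k + j))

/-- The `n`-th natural number different from `i`. -/
def skip (i n : ℕ) : ℕ := if n < i then n else n + 1

theorem val_succAbove {n : ℕ} (i : Fin (n + 1)) (j : Fin n) :
    (i.succAbove j : ℕ) = skip i j := by
  simp only [Fin.succAbove, skip, Fin.lt_def, Fin.val_castSucc]
  split_ifs <;> simp

theorem succAbove_ofNat {q : ℕ} (i : Fin (q + 2)) {n : ℕ} (hn : n ≤ q) :
    i.succAbove (Fin.ofNat (q + 1) n) = Fin.ofNat (q + 2) (skip i n) := by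
  ext
  rw [val_succAbove]
  have h1 : skip i n < q + 2 := by unfold skip; split_ifs <;> omega
  simp [Nat.mod_eq_of_lt (show n < q + 1 by omega), Nat.mod_eq_of_lt h1]

/-- An Alexander–Whitney computation. Deleting coordinate `i` of `z` deletes an `x`-variable if `i <
k` and a `y`-variable if `i > k`. The sums `A` and `C` collect faces that keep the junction
coordinate `z_k` on both sides (with the shifted indexing), and the single term `T` is the extra
face common to `∂_x τ` and `∂_y τ`. -/
theorem spread_coboundary {q k b : ℕ} (hq : q = k + b) (h : G)
    (τ : (Fin (k + 1) → G) → (Fin (b + 1) → G) → B) (z : Fin (q + 2) → G) :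
    spread (q + 1) h (fun x => coboundary (τ x)) z =
      spread (q + 1) h (fun (x : Fin (k + 1 + 1) → G) y =>
        (-1 : ℤ) ^ (k + 1) • coboundary (fun x => τ x y) x) z +
      (-1 : ℤ) ^ k • coboundary (spread q h τ) z := by
  subst hq
  obtain ⟨Z, hZ⟩ : ∃ Z : ℕ → G, ∀ n, z (Fin.ofNat (k + b + 2) n) = Z n := ⟨_, fun _ => rfl⟩
  have e1 : coboundary (spread (k + b) h τ) z = ∑ i ∈ Finset.range (k + 1 + (b + 1)),
      (-1 : ℤ) ^ i • τ (fun a => Z (skip i a) * h) fun j => Z (skip i (k + j)) := by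
    rw [show k + 1 + (b + 1) = k + b + 2 by ring, Finset.sum_range]
    refine Finset.sum_congr rfl fun i _ => ?_
    congr 1
    simp only [spread]
    congr 1
    · funext a
      rw [succAbove_ofNat i (by omega), hZ]
    · funext j
      rw [succAbove_ofNat i (by omega), hZ]
  have e2 : spread (k + b + 1) h (fun x => coboundary (τ x)) z = ∑ i ∈ Finset.range (b + 2),
      (-1 : ℤ) ^ i • τ (fun a => Z a * h) fun j => Z (k + skip i j) := by
    rw [Finset.sum_range]
    simp only [spread, coboundary]
    refine Finset.sum_congr rfl fun i _ => ?_
    simp only [hZ, val_succAbove]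
  have e3 : spread (k + b + 1) h (fun (x : Fin (k + 1 + 1) → G) y =>
      (-1 : ℤ) ^ (k + 1) • coboundary (fun x => τ x y) x) z = (-1 : ℤ) ^ (k + 1) •
        ∑ i ∈ Finset.range (k + 2),
          (-1 : ℤ) ^ i • τ (fun a => Z (skip i a) * h) fun j => Z (k + 1 + j) := by
    rw [Finset.sum_range]
    simp only [spread, coboundary]
    congr 1
    refine Finset.sum_congr rfl fun i _ => ?_
    simp only [hZ, val_succAbove]
  set A := ∑ i ∈ Finset.range (k + 1),
    (-1 : ℤ) ^ i • τ (fun a => Z (skip i a) * h) fun j => Z (k + 1 + j) with hA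
  set T := τ (fun a => Z a * h) fun j => Z (k + 1 + j) with hT
  set C := ∑ i ∈ Finset.range (b + 1),
    (-1 : ℤ) ^ i • τ (fun a => Z a * h) fun j => Z (k + skip (i + 1) j) with hC
  have s1 : coboundary (spread (k + b) h τ) z = A + (-1 : ℤ) ^ (k + 1) • C := by
    rw [e1, Finset.sum_range_add, hC, Finset.smul_sum]
    congr 1
    · refine Finset.sum_congr rfl fun i hi => ?_
      have hi' := Finset.mem_range.1 hi
      congr 2
      funext j
      congr 1
      unfold skip
      rw [if_neg (by omega)]
      omega
    · refine Finset.sum_congr rfl fun i hi => ?_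
      rw [smul_smul, ← pow_add]
      congr 2
      · funext a
        unfold skip
        rw [if_pos (by omega)]
      · funext j
        congr 1
        unfold skip
        split_ifs <;> omega
  have s2 : spread (k + b + 1) h (fun x => coboundary (τ x)) z = T - C := by
    rw [e2, Finset.sum_range_succ', add_comm, sub_eq_add_neg, hC, ← Finset.sum_neg_distrib]
    congr 1
    · rw [hT, pow_zero, one_smul]
      congr 1
      funext j
      simp only [skip, not_lt_zero, if_false]
      congr 1
      omega
    · refine Finset.sum_congr rfl fun i _ => ?_
      rw [← neg_smul, pow_succ, mul_neg_one]
  have s3 : ∑ i ∈ Finset.range (k + 2),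
      (-1 : ℤ) ^ i • τ (fun a => Z (skip i a) * h) (fun j => Z (k + 1 + j)) =
        A + (-1 : ℤ) ^ (k + 1) • T := by
    rw [Finset.sum_range_succ, hA, hT]
    congr 3
    funext a
    unfold skip
    rw [if_pos a.2]
  rw [e3, s1, s2, s3]
  rcases Nat.even_or_odd k with hk | hk
  · rw [hk.neg_one_pow, hk.add_one.neg_one_pow]
    simp only [neg_smul, one_smul]
    abel
  · rw [hk.neg_one_pow, hk.add_one.neg_one_pow]
    simp only [neg_smul, one_smul]
    abel

theorem measurePreserving_split (k n : ℕ) :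
    MeasurePreserving (fun z : Fin (k + n) → G =>
      ((fun i => z (Fin.castAdd n i), fun j => z (Fin.natAdd k j)) : (Fin k → G) × (Fin n → G)))
      (powMeasure μ (k + n)) ((powMeasure μ k).prod (powMeasure μ n)) :=
  (measurePreserving_sumPiEquivProdPi (fun _ : Fin k ⊕ Fin n => μ)).comp
    (measurePreserving_piCongrLeft (fun _ : Fin (k + n) => μ) finSumFinEquiv).symm

theorem measurePreserving_snoc (b : ℕ) :
    MeasurePreserving (fun z : G × (Fin b → G) => (Fin.snoc z.2 z.1 : Fin (b + 1) → G))
      (μ.prod (powMeasure μ b)) (powMeasure μ (b + 1)) := by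
  convert (measurePreserving_piFinSuccAbove (fun _ : Fin (b + 1) => μ) (Fin.last b)).symm using 1
  funext z
  exact (Fin.insertNth_last' z.1 z.2).symm

/-- For fixed `g` the tuples share the coordinate `z_k` and may all lie in a null set, so the
hypothesis says nothing about them. With `g` variable too, for each fixed `y` the last
`x`-coordinate `y 0 * g` is generic by left invariance and the others, right translates by `g`, are
generic as well; Fubini then exchanges the quantifiers. -/
theorem ae_ae_spread {p k b : ℕ} (hp : p = k + b) {S : Set ((Fin (k + 1) → G) × (Fin (b + 1) → G))}
    (hS : MeasurableSet S) (h : ∀ x, ∀ᵐ y ∂powMeasure μ (b + 1), (x, y) ∈ S) :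
    ∀ᵐ g ∂μ, ∀ᵐ z ∂powMeasure μ (p + 1),
      ((fun i => z (Fin.ofNat (p + 1) i) * g : Fin (k + 1) → G),
        (fun j => z (Fin.ofNat (p + 1) (k + j)) : Fin (b + 1) → G)) ∈ S := by
  subst hp
  let f : (Fin (b + 1) → G) × G × (Fin k → G) → (Fin (k + 1) → G) × (Fin (b + 1) → G) := fun q =>
    (Fin.snoc (fun i => q.2.2 i * q.2.1) (q.1 0 * q.2.1), q.1)
  have hf : Measurable f := by
    have h1 : Measurable fun q : (Fin (b + 1) → G) × G × (Fin k → G) =>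
      ((q.1 0 * q.2.1, fun i => q.2.2 i * q.2.1) : G × (Fin k → G)) := by fun_prop
    exact ((measurePreserving_snoc (μ := μ) k).measurable.comp h1).prodMk measurable_fst
  have hfS : MeasurableSet (f ⁻¹' S) := hf hS
  have h1 : ∀ᵐ y ∂powMeasure μ (b + 1), ∀ᵐ x ∂powMeasure μ (k + 1), (x, y) ∈ S :=
    (Measure.ae_ae_comm (p := fun x y => (x, y) ∈ S) hS).1 (Eventually.of_forall h)
  have h2 : ∀ᵐ y ∂powMeasure μ (b + 1), ∀ᵐ q ∂μ.prod (powMeasure μ k), (y, q) ∈ f ⁻¹' S := by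
    filter_upwards [h1] with y hy
    have h3 := Measure.ae_ae_of_ae_prod
      ((measurePreserving_snoc (μ := μ) k).quasiMeasurePreserving.ae hy)
    have h4 := (measurePreserving_mul_left μ (y 0)).quasiMeasurePreserving.ae h3
    refine (Measure.ae_prod_iff_ae_ae (measurable_prodMk_left hfS)).2 ?_
    filter_upwards [h4] with g hg
    exact (quasiMeasurePreserving_mul_right (powMeasure μ k) (fun _ => g)).ae hg
  have h3 : ∀ᵐ q ∂μ.prod (powMeasure μ k), ∀ᵐ y ∂powMeasure μ (b + 1), (y, q) ∈ f ⁻¹' S :=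
    (Measure.ae_ae_comm (p := fun y q => (y, q) ∈ f ⁻¹' S) hfS).1 h2
  filter_upwards [Measure.ae_ae_of_ae_prod h3] with g hg
  have hgm : Measurable fun v : (Fin k → G) × (Fin (b + 1) → G) => (v.2, g, v.1) := by fun_prop
  have h4 := (Measure.ae_prod_iff_ae_ae (p := fun v : (Fin k → G) × (Fin (b + 1) → G) =>
    (v.2, g, v.1) ∈ f ⁻¹' S) (hgm hfS)).2 hg
  filter_upwards [(measurePreserving_split (μ := μ) k (b + 1)).quasiMeasurePreserving.ae h4] with z hz
  have hj : ∀ j : Fin (b + 1), Fin.ofNat (k + b + 1) (k + j) = Fin.natAdd k j := by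
    intro j
    ext
    simp [Nat.mod_eq_of_lt (show k + (j : ℕ) < k + b + 1 by omega)]
  have hz' : f ((fun j => z (Fin.natAdd k j)), g, fun i => z (Fin.castAdd (b + 1) i)) ∈ S := hz
  simp only [hj]
  convert hz' using 1
  refine congrArg (Prod.mk · _) ?_
  funext i
  refine Fin.lastCases ?_ (fun i => ?_) i
  · rw [Fin.snoc_last]
    change _ = z (Fin.natAdd k (0 : Fin (b + 1))) * g
    rw [← hj 0]
    rfl
  · rw [Fin.snoc_castSucc]
    congr 2
    ext
    simp [Nat.mod_eq_of_lt (show (i : ℕ) < k + b + 1 by omega)]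

variable (μ) in
/-- Two functions on `G^(p+1)` differ almost everywhere by the coboundary of a measurable
equivariant function. -/
def IsCohomologous (p : ℕ) (f f' : (Fin (p + 1) → G) → B) : Prop :=
  ∃ Q : (Fin p → G) → B, Measurable Q ∧ (∀ g x, Q (fun i => g * x i) = g • Q x) ∧
    (p = 0 → Q = 0) ∧ f =ᵐ[powMeasure μ (p + 1)] fun z => f' z + coboundary Q z

/-- The descent through the double complex, by induction on `b`. Each step replaces `φ` by
`(-1)^(k+1) ∂_x τ` with `∂_y τ = φ`, and by `spread_coboundary` adds `(-1)^k` times the spread of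
`τ` to the bounding cochain. -/
theorem exists_isRegular_isCohomologous (h𝒩 : IsTameSystem μ 𝒩) {b k p : ℕ} (hp : p = k + b)
    {φ : (Fin (k + 1) → G) → (Fin (b + 1) → G) → B} (hφ : IsRegular μ 𝒩 φ)
    (h0 : ∀ x y, coboundary (fun x => φ x y) x = 0)
    (h1 : ∀ x, ∀ᵐ y ∂powMeasure μ (b + 2), coboundary (φ x) y = 0) :
    ∃ τ : (Fin (p + 1) → G) → (Fin 0 → G) → B, IsRegular μ 𝒩 τ ∧
      (∀ x, coboundary (fun x => τ x default) x = 0) ∧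
      ∀ᵐ h ∂μ, IsCohomologous μ p (spread p h φ) fun z => τ (fun i => z i * h) default := by
  have hae : ∀ {b k p : ℕ} (_ : p = k + b) {φ : (Fin (k + 1) → G) → (Fin (b + 1) → G) → B}
      (_ : IsRegular μ 𝒩 φ) {τ : (Fin (k + 1) → G) → (Fin b → G) → B} (_ : IsRegular μ 𝒩 τ)
      (_ : ∀ x, ∀ᵐ y ∂powMeasure μ (b + 1), coboundary (τ x) y = φ x y),
      ∀ᵐ h ∂μ, spread p h φ =ᵐ[powMeasure μ (p + 1)] spread p h fun x => coboundary (τ x) := by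
    intro b k p hp φ hφ τ hτ H
    have hm : Measurable fun z : (Fin (k + 1) → G) × (Fin (b + 1) → G) => coboundary (τ z.1) z.2 := by
      refine measurable_coboundary
        (f := fun z : (Fin (k + 1) → G) × (Fin (b + 1) → G) => τ z.1) (y := fun z => z.2) fun i => ?_
      have h1 : Measurable fun z : (Fin (k + 1) → G) × (Fin (b + 1) → G) =>
        (z.1, fun j => z.2 (i.succAbove j)) := by fun_prop
      exact hτ.measurable.comp h1
    filter_upwards [ae_ae_spread (μ := μ) hp (measurableSet_eq_fun hm hφ.measurable) H] with h hh
    filter_upwards [hh] with z hz using hz.symm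
  have hcob : ∀ {b k : ℕ} {φ : (Fin (k + 1) → G) → (Fin (b + 1) → G) → B}
      (_ : ∀ x y, coboundary (fun x => φ x y) x = 0) {τ : (Fin (k + 1) → G) → (Fin b → G) → B}
      (_ : ∀ x, ∀ᵐ y ∂powMeasure μ (b + 1), coboundary (τ x) y = φ x y) (x : Fin (k + 2) → G),
      ∀ᵐ y ∂powMeasure μ (b + 1), coboundary (fun y => coboundary (fun x => τ x y) x) y = 0 := by
    intro b k φ h0 τ hτ x
    filter_upwards [ae_all_iff.2 fun i : Fin (k + 2) => hτ fun j => x (i.succAbove j)] with y hy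
    rw [coboundary_comm, ← h0 x y]
    exact coboundary_congr hy
  induction b generalizing k with
  | zero =>
    obtain ⟨τ, hτ, H⟩ := hφ.exists_primitive h𝒩 h1
    obtain rfl : p = k := hp
    refine ⟨τ, hτ, fun x => ?_, ?_⟩
    · obtain ⟨y, hy⟩ := (hcob h0 H x).exists
      simpa [coboundary, Subsingleton.elim _ (default : Fin 0 → G)] using hy
    · filter_upwards [hae rfl hφ hτ H] with h hh
      refine ⟨0, measurable_const, by simp, fun _ => rfl, ?_⟩
      filter_upwards [hh] with z hz
      refine hz.trans ?_
      simp [spread, coboundary, Subsingleton.elim _ (default : Fin 0 → G), Fin.ofNat_eq_cast]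
  | succ b ih =>
    obtain ⟨τ, hτ, H⟩ := hφ.exists_primitive h𝒩 h1
    obtain ⟨τ', hτ', hτ'0, H'⟩ := ih (k := k + 1) (by omega)
      ((hτ.coboundary h𝒩).zsmul ((-1) ^ (k + 1)))
      (fun x y => by rw [coboundary_zsmul, coboundary_coboundary, smul_zero])
      (fun x => by
        filter_upwards [hcob h0 H x] with y hy
        rw [coboundary_zsmul, hy, smul_zero])
    refine ⟨τ', hτ', hτ'0, ?_⟩
    filter_upwards [H', hae hp hφ hτ H] with h hh hh'
    -- Here `p > 0`, so the spread of `τ` is a cochain on `G^p` and the condition `p = 0 → Q = 0` is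
    -- empty.
    obtain ⟨q, rfl⟩ : ∃ q, p = q + 1 := ⟨k + b, hp⟩
    obtain ⟨Q, hQm, hQe, hQ0, hQ⟩ := hh
    have hsm : Measurable (spread q h τ) := by
      have h2 : Measurable fun z : Fin (q + 1) → G =>
        ((fun i => z (Fin.ofNat (q + 1) i) * h, fun j => z (Fin.ofNat (q + 1) (k + j))) :
          (Fin (k + 1) → G) × (Fin (b + 1) → G)) := by fun_prop
      exact hτ.measurable.comp h2
    refine ⟨fun z => Q z + (-1 : ℤ) ^ k • spread q h τ z,
      hQm.add ((measurable_of_countable fun b : B => _ • b).comp hsm), fun g x => ?_, by simp, ?_⟩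
    · have h2 : spread q h τ (fun i => g * x i) = g • spread q h τ x := by
        simp only [spread, mul_assoc]
        rw [← hτ.equivariant]
      simp only [hQe, h2, smul_add]
      rw [smul_comm]
    · filter_upwards [hQ, hh'] with z h2 h3
      rw [h3, spread_coboundary (by omega), h2, coboundary_add, coboundary_zsmul]
      abel

end Regular

section System

variable {G : Type*} [Group G] [TopologicalSpace G] [IsTopologicalGroup G] [LocallyCompactSpace G]
  [SecondCountableTopology G] [T2Space G] [MeasurableSpace G] [BorelSpace G] (μ : Measure G)
  [μ.IsHaarMeasure]

/-! ### Construction of tame systems -/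

/-- A system of Boolean algebras of subsets of the powers of `G`, stable under the structure maps of
the homogeneous bar resolution, and containing small sublevel sets of continuous functions. -/
structure IsStableSystem (𝒮 : ∀ q : ℕ, Set (Set (Fin q → G))) : Prop where
  compl : ∀ q, ∀ C ∈ 𝒮 q, Cᶜ ∈ 𝒮 q
  inter : ∀ q, ∀ C ∈ 𝒮 q, ∀ D ∈ 𝒮 q, C ∩ D ∈ 𝒮 q
  sublevel : ∀ q (x : Fin q → G), ∀ U ∈ 𝓝 x, ∃ f : (Fin q → G) → ℝ, Continuous f ∧ f x = 0 ∧
    (∀ r, {z | f z < r} ∈ 𝒮 q) ∧ ∃ ε > 0, {z | f z < ε} ⊆ U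
  face : ∀ q (i : Fin (q + 1)), ∀ C ∈ 𝒮 q,
    (fun (x : Fin (q + 1) → G) j => x (i.succAbove j)) ⁻¹' C ∈ 𝒮 (q + 1)
  quot : ∀ q, ∀ C ∈ 𝒮 q, (fun (x : Fin (q + 1) → G) (j : Fin q) => (x 0)⁻¹ * x j.succ) ⁻¹' C ∈ 𝒮 (q + 1)
  mul_right : ∀ q (h : G), ∀ C ∈ 𝒮 q, (fun (x : Fin q → G) j => x j * h) ⁻¹' C ∈ 𝒮 q

/-- For fixed first coordinate the map is a left translation of the remaining ones. -/
theorem quasiMeasurePreserving_quot (q : ℕ) :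
    Measure.QuasiMeasurePreserving (fun (x : Fin (q + 1) → G) (j : Fin q) => (x 0)⁻¹ * x j.succ)
      (powMeasure μ (q + 1)) (powMeasure μ q) := by
  have h1 : Measure.QuasiMeasurePreserving
      (fun (z : G × (Fin q → G)) j => z.1⁻¹ * z.2 j) (μ.prod (powMeasure μ q)) (powMeasure μ q) :=
    QuasiMeasurePreserving.prod_of_right (by fun_prop) (Eventually.of_forall fun g =>
      (measurePreserving_diag μ q g⁻¹).quasiMeasurePreserving)
  exact h1.comp (measurePreserving_piFinSuccAbove (fun _ : Fin (q + 1) => μ) 0).quasiMeasurePreserving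

variable {μ} in
theorem null_frontier_preimage {m n : ℕ} {f : (Fin m → G) → Fin n → G} (hf : Continuous f)
    (hq : Measure.QuasiMeasurePreserving f (powMeasure μ m) (powMeasure μ n)) {C : Set (Fin n → G)}
    (hC : powMeasure μ n (frontier C) = 0) : powMeasure μ m (frontier (f ⁻¹' C)) = 0 :=
  measure_mono_null (hf.frontier_preimage_subset C) (hq.preimage_null hC)

/-- The Borel sets with null frontier that belong to a given system. -/
def nullFrontierSystem (𝒮 : ∀ q : ℕ, Set (Set (Fin q → G))) (q : ℕ) : Set (Set (Fin q → G)) :=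
  {C | C ∈ 𝒮 q ∧ MeasurableSet C ∧ powMeasure μ q (frontier C) = 0}

/-- The structure maps are continuous and pull null sets back to null sets, so null frontiers
persist; sublevel sets of suitable radius supply the neighbourhood basis. -/
theorem IsStableSystem.isTameSystem {𝒮 : ∀ q : ℕ, Set (Set (Fin q → G))} (h : IsStableSystem 𝒮) :
    IsTameSystem μ (nullFrontierSystem μ 𝒮) where
  alg q :=
    { compl := fun C hC => ⟨h.compl q C hC.1, hC.2.1.compl, by rw [frontier_compl]; exact hC.2.2⟩
      inter := fun C hC D hD => ⟨h.inter q C hC.1 D hD.1, hC.2.1.inter hD.2.1,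
        measure_mono_null ((frontier_inter_subset C D).trans (Set.union_subset_union
          Set.inter_subset_left Set.inter_subset_right)) (measure_union_null hC.2.2 hD.2.2)⟩
      univ := by
        refine ⟨?_, MeasurableSet.univ, by simp⟩
        obtain ⟨f, -, -, hf, -⟩ := h.sublevel q 1 Set.univ univ_mem
        have := h.compl q _ (h.inter q _ (hf 0) _ (h.compl q _ (hf 0)))
        rwa [Set.inter_compl_self, Set.compl_empty] at this
      basis := by
        intro x U hU
        obtain ⟨f, hf, hfx, hf𝒮, ε, hε, hfU⟩ := h.sublevel q x U hU
        -- Disjoint level sets: only countably many have positive measure, so some radius in `(0,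
        -- ε)` has a null one, and this contains the frontier.
        have hc : {r : ℝ | 0 < powMeasure μ q {z | f z = r}}.Countable :=
          Measure.countable_meas_level_set_pos hf.measurable
        obtain ⟨r, hr, hr'⟩ : ∃ r ∈ Set.Ioo 0 ε, r ∉ {r : ℝ | 0 < powMeasure μ q {z | f z = r}} := by
          by_contra! hcon
          exact Cardinal.Real.Ioo_countable_iff.not.2 (not_le.2 hε) (hc.mono hcon)
        refine ⟨{z | f z < r}, ⟨hf𝒮 r, (isOpen_lt hf continuous_const).measurableSet, ?_⟩,
          isOpen_lt hf continuous_const, by simpa [hfx] using hr.1, fun z hz => hfU ?_⟩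
        · have h0 : powMeasure μ q {z | f z = r} = 0 := le_zero_iff.1 (not_lt.1 hr')
          exact measure_mono_null (frontier_lt_subset_eq hf continuous_const) h0
        · exact lt_trans (show f z < r from hz) hr.2 }
  measurableSet _ _ hC := hC.2.1
  null_frontier _ _ hC := hC.2.2
  face q i C hC := ⟨h.face q i C hC.1, (quasiMeasurePreserving_face μ q i).measurable hC.2.1,
    null_frontier_preimage (by fun_prop) (quasiMeasurePreserving_face μ q i) hC.2.2⟩
  quot q C hC := ⟨h.quot q C hC.1, (quasiMeasurePreserving_quot μ q).measurable hC.2.1,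
    null_frontier_preimage (by fun_prop) (quasiMeasurePreserving_quot μ q) hC.2.2⟩
  mul_right q g C hC := by
    have hq := quasiMeasurePreserving_mul_right (powMeasure μ q) fun _ => g
    exact ⟨h.mul_right q g C hC.1, hq.measurable hC.2.1,
      null_frontier_preimage (by fun_prop) hq hC.2.2⟩

/-! ### Functions constant on the level sets of a labelling -/

theorem IsLabel.locallyFiniteValued {X A : Type*} [TopologicalSpace X] {𝒩 : Set (Set X)} {x₀ : X}
    {N : X → ℕ} (hN : IsLabel 𝒩 x₀ N) {f : X → A} (hf : ∀ x x', N x = N x' → f x = f x') :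
    LocallyFiniteValued f := by
  intro x
  obtain ⟨S, hS, hx⟩ := hN.locFin x
  have h1 : ∀ n, ∃ a, ∀ z, N z = n → f z = a := by
    intro n
    by_cases h : ∃ z, N z = n
    · exact ⟨f h.choose, fun z hz => hf _ _ (hz.trans h.choose_spec.symm)⟩
    · exact ⟨f x, fun z hz => (h ⟨z, hz⟩).elim⟩
  choose a ha using h1
  refine ⟨_, hx, (hS.image a).subset ?_⟩
  rintro _ ⟨y, hy, rfl⟩
  exact ⟨N y, hy, (ha _ y rfl).symm⟩

/-- Away from the frontiers of the countably many level sets `f` is locally constant. Their union is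
null, and a conull set is dense since nonempty open sets have positive measure. -/
theorem IsLabel.locallyConstantOnFullDenseOpen {X A : Type*} [TopologicalSpace X]
    [MeasurableSpace X] {ν : Measure X} [ν.IsOpenPosMeasure] {𝒩 : Set (Set X)}
    (h𝒩 : ∀ C ∈ 𝒩, ν (frontier C) = 0) {x₀ : X} {N : X → ℕ} (hN : IsLabel 𝒩 x₀ N) {f : X → A}
    (hf : ∀ x x', N x = N x' → f x = f x') : LocallyConstantOnFullDenseOpen ν f := by
  have h0 : ν {x | ∀ᶠ y in 𝓝 x, f y = f x}ᶜ = 0 := by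
    refine measure_mono_null (t := ⋃ n, frontier (N ⁻¹' {n})) (fun x hx => ?_)
      (measure_iUnion_null fun n => h𝒩 _ (hN.mem n))
    refine Set.mem_iUnion.2 ⟨N x, subset_closure rfl, fun hxi => hx ?_⟩
    filter_upwards [mem_interior_iff_mem_nhds.1 hxi] with y hy using hf _ _ hy
  refine ⟨_, isOpen_iff_mem_nhds.2 fun x hx => ?_, Measure.dense_of_ae (ae_iff.2 h0), h0,
    fun x hx => hx⟩
  have hx' : ∀ᶠ y in 𝓝 x, f y = f x := hx
  filter_upwards [hx'.eventually_nhds, hx'] with y h1 h2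
  filter_upwards [h1] with z hz using hz.trans h2.symm

theorem IsLabel.exists_isPartition {X A : Type*} [TopologicalSpace X] {𝒩 : Set (Set X)} {x₀ : X}
    {N : X → ℕ} (hN : IsLabel 𝒩 x₀ N) {f : X → A} (hf : ∀ x x', N x = N x' → f x = f x') :
    ∃ P : Set (Set X), Setoid.IsPartition P ∧ LocallyFinite (Subtype.val : P → Set X) ∧
      (∀ C ∈ P, C ∈ 𝒩) ∧ ∀ C ∈ P, ∀ x ∈ C, ∀ y ∈ C, f x = f y := by
  refine ⟨Set.range fun x => N ⁻¹' {N x}, ⟨?_, fun x => ?_⟩, fun x => ?_, ?_, ?_⟩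
  · rintro ⟨x, hx⟩
    exact Set.notMem_empty x (hx ▸ (rfl : N x = N x))
  · refine ⟨N ⁻¹' {N x}, ⟨⟨x, rfl⟩, rfl⟩, ?_⟩
    rintro _ ⟨⟨y, rfl⟩, hy⟩
    rw [show N x = N y from hy]
  · obtain ⟨S, hS, hx⟩ := hN.locFin x
    refine ⟨_, hx, Set.Finite.of_injOn (f := Subtype.val) (t := (fun n => N ⁻¹' {n}) '' S) ?_
      Subtype.val_injective.injOn (hS.image _)⟩
    rintro ⟨_, y, rfl⟩ ⟨z, hz, hzS⟩
    refine ⟨N z, hzS, ?_⟩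
    rw [show N z = N y from hz]
  · rintro _ ⟨x, rfl⟩
    exact hN.mem _
  · rintro _ ⟨x, rfl⟩ y hy z hz
    exact hf _ _ (Eq.trans hy (Eq.symm hz))

end System

/-! ### Strictly equivariant representatives and coefficients in a countable module -/

section Reduction

variable {G : Type*} [Group G] [TopologicalSpace G] [IsTopologicalGroup G] [LocallyCompactSpace G]
  [SecondCountableTopology G] [T2Space G] [MeasurableSpace G] [BorelSpace G] {μ : Measure G}
  [μ.IsHaarMeasure]

section Countable

variable {B : Type*} [AddCommGroup B] [Countable B] [TopologicalSpace B] [DiscreteTopology B]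
  [MeasurableSpace B] [DiscreteMeasurableSpace B] [DistribMulAction G B] [ContinuousSMul G B]

/-- A measurable function whose class is invariant agrees almost everywhere with an equivariant
one. -/
theorem exists_equivariant_ae_eq {p : ℕ} {s : (Fin (p + 1) → G) → B} (hs : Measurable s)
    (h : ∀ g : G, ∀ᵐ x ∂powMeasure μ (p + 1), g • s (fun i => g⁻¹ * x i) = s x) :
    ∃ σ : (Fin (p + 1) → G) → B, Measurable σ ∧ (∀ g x, σ (fun i => g * x i) = g • σ x) ∧
      σ =ᵐ[powMeasure μ (p + 1)] s := by
  let f : G × (Fin (p + 1) → G) → B := fun z => z.1 • s fun i => z.1⁻¹ * z.2 i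
  have hf : Measurable f := measurable_smul_of_discrete.comp
    (measurable_fst.prodMk (hs.comp (by fun_prop)))
  have hS : MeasurableSet {z : G × (Fin (p + 1) → G) | f z = s z.2} :=
    measurableSet_eq_fun hf (hs.comp measurable_snd)
  have h1 : ∀ᵐ x ∂powMeasure μ (p + 1), ∀ᵐ g ∂μ, f (g, x) = s x :=
    (Measure.ae_ae_comm (p := fun g x => f (g, x) = s x) hS).1 (Eventually.of_forall h)
  -- Substituting `x 0 * g⁻¹` for `g` makes `x ↦ f (x 0 * g⁻¹, x)` equivariant for each fixed `g`;
  -- by Fubini it agrees with `s` almost everywhere for a generic `g`.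
  have h2 : ∀ᵐ x ∂powMeasure μ (p + 1), ∀ᵐ g ∂μ, f (x 0 * g⁻¹, x) = s x := by
    filter_upwards [h1] with x hx
    exact ((measurePreserving_mul_left μ (x 0)).quasiMeasurePreserving.comp
      (quasiMeasurePreserving_inv μ)).ae hx
  have hm : Measurable fun z : (Fin (p + 1) → G) × G => (z.1 0 * z.2⁻¹, z.1) := by fun_prop
  have h3 : ∀ᵐ g ∂μ, ∀ᵐ x ∂powMeasure μ (p + 1), f (x 0 * g⁻¹, x) = s x :=
    (Measure.ae_ae_comm (p := fun x g => f (x 0 * g⁻¹, x) = s x) (hm hS)).1 h2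
  obtain ⟨g, hg⟩ := h3.exists
  refine ⟨fun x => f (x 0 * g⁻¹, x), hf.comp (hm.comp measurable_prodMk_right), fun k x => ?_, hg⟩
  simp only [f, mul_inv_rev, mul_smul, mul_assoc, inv_mul_cancel_left]

/-- Every measurable equivariant cocycle with values in a countable module is cohomologous to one
that is constant on the level sets of a labelling. -/
theorem exists_isLabel_isCohomologous {𝒩 : ∀ q : ℕ, Set (Set (Fin q → G))} (h𝒩 : IsTameSystem μ 𝒩)
    {p : ℕ} {σ : (Fin (p + 1) → G) → B} (hm : Measurable σ)
    (he : ∀ g x, σ (fun i => g * x i) = g • σ x)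
    (h0 : ∀ᵐ x ∂powMeasure μ (p + 2), coboundary σ x = 0) :
    ∃ σ' : (Fin (p + 1) → G) → B, (∀ g x, σ' (fun i => g * x i) = g • σ' x) ∧
      (∀ x, coboundary σ' x = 0) ∧ IsCohomologous μ p σ σ' ∧ (∀ᶠ x in 𝓝 1, σ' x = σ' 1) ∧
      ∃ (x₀ : Fin (p + 1) → G) (N : (Fin (p + 1) → G) → ℕ), IsLabel (𝒩 (p + 1)) x₀ N ∧
        ∀ x x', N x = N x' → σ' x = σ' x' := by
  -- The start of the descent: one dummy variable, on which nothing depends.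
  have hreg : IsRegular μ 𝒩 fun (_ : Fin (0 + 1) → G) (y : Fin (p + 1) → G) => σ y :=
    { equivariant := fun g x y => he g y
      measurable := hm.comp measurable_snd
      tame := IsTame.const (h𝒩.alg _) _
      tame_slice := IsTame.const (h𝒩.alg _) _ }
  obtain ⟨τ, hτ, hτ0, H⟩ := exists_isRegular_isCohomologous h𝒩 (Nat.zero_add p).symm hreg
    (fun x y => by simp [coboundary, Fin.sum_univ_two]) fun _ => h0
  obtain ⟨h, hh⟩ := H.exists
  -- The space `G^0` is a point of mass one, so any tolerance below `1` forces equality on level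
  -- sets.
  obtain ⟨N, hN, hNτ⟩ := hτ.tame 2⁻¹ (by simp)
  have hN' : ∀ x x', N x = N x' → τ x default = τ x' default := by
    intro x x' hx
    by_contra hne
    have h1 := hNτ x x' hx
    have h2 : {y : Fin 0 → G | τ x y ≠ τ x' y} = Set.univ :=
      Set.eq_univ_of_forall fun y => by rwa [Subsingleton.elim y default]
    rw [h2, measure_univ] at h1
    exact absurd h1 (by simp)
  have he' : ∀ g x, τ (fun i => g * x i) default = g • τ x default := fun g x => by
    rw [← hτ.equivariant, Subsingleton.elim (fun i => g * (default : Fin 0 → G) i) default]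
  refine ⟨fun z => τ (fun i => z i * h) default, fun g x => ?_, fun x => hτ0 fun i => x i * h, ?_, ?_,
    fun _ => h⁻¹, fun z => N fun i => z i * h,
    hN.comp (f := fun (z : Fin (p + 1) → G) i => z i * h) (by fun_prop) (h𝒩.mul_right _ h) (by ext; simp),
    fun x x' hx => hN' _ _ hx⟩
  · simp only [mul_assoc, he']
  · convert hh using 1
    funext z
    simp [spread]
  -- The labelling of `z ↦ τ(zh)` is constant near `h⁻¹`, not near `1`. Equivariance gives `τ(zh) =
  -- h • τ(h⁻¹zh)`, and conjugation fixes `1`, where `τ` is locally constant.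
  · have h1 : Tendsto (fun (z : Fin (p + 1) → G) i => h⁻¹ * (z i * h)) (𝓝 1) (𝓝 1) := by
      have : Continuous fun (z : Fin (p + 1) → G) i => h⁻¹ * (z i * h) := by fun_prop
      convert this.continuousAt.tendsto (x := 1) using 2
      ext; simp
    filter_upwards [h1.eventually hN.near] with z hz
    have h2 : ∀ w : Fin (p + 1) → G,
        τ (fun i => w i * h) default = h • τ (fun i => h⁻¹ * (w i * h)) default := fun w => by
      rw [he', smul_inv_smul]
    rw [h2 z, h2 1, hN' _ _ hz]
    congr 2
    ext; simp

end Countable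

variable {A : Type*} [AddCommGroup A] [TopologicalSpace A] [DiscreteTopology A]

/-- The signs `(-1)^(q-i)` and `(-1)^i` differ by the global factor `(-1)^q`. Passing to germs lets
the finite sum be handled additively. -/
theorem coeFn_d (q : ℕ) (φ : Cochain μ A q) : ⇑(d μ A q φ) =ᵐ[powMeasure μ (q + 1)]
    fun x => (-1 : ℤ) ^ q • coboundary φ x := by
  have h1 : (d μ A q φ).toGerm = (((fun x => (-1 : ℤ) ^ q • coboundary φ x) :
      (Fin (q + 1) → G) → A) : (ae (powMeasure μ (q + 1))).Germ A) := by
    have h2 : ∀ i : Fin (q + 1), (face μ A q i φ).toGerm =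
        Germ.coeAddHom _ (fun x : Fin (q + 1) → G => φ fun j => x (i.succAbove j)) := fun i => by
      rw [AEEqFun.toGerm_eq]
      exact Germ.coe_eq.2 (coeFn_face μ A q i φ)
    have h3 : (d μ A q φ).toGerm = Germ.coeAddHom _ (∑ i : Fin (q + 1), (-1 : ℤ) ^ (q - (i : ℕ)) •
        fun x : Fin (q + 1) → G => φ fun j => x (i.succAbove j)) := by
      rw [d_apply, ← AEEqFun.toGermAddMonoidHom_apply, map_sum, map_sum]
      refine Finset.sum_congr rfl fun i _ => ?_
      rw [map_zsmul, map_zsmul, AEEqFun.toGermAddMonoidHom_apply, h2]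
    rw [h3]
    refine congrArg _ ?_
    funext x
    simp only [coboundary, Finset.smul_sum, Finset.sum_apply, Pi.smul_apply, smul_smul, ← pow_add]
    refine Finset.sum_congr rfl fun i _ => ?_
    congr 1
    have hi : (i : ℕ) ≤ q := Nat.lt_succ_iff.1 i.2
    rw [show q + (i : ℕ) = q - i + 2 * i by omega, pow_add, pow_mul]
    simp
  rw [AEEqFun.toGerm_eq] at h1
  exact Germ.coe_eq.1 h1

variable [DistribMulAction G A] [ContinuousSMul G A]

theorem exists_represents_of_countable {𝒩 : ∀ q : ℕ, Set (Set (Fin q → G))}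
    (h𝒩 : IsTameSystem μ 𝒩) {B : Type*} [AddCommGroup B] [Countable B] [TopologicalSpace B]
    [DiscreteTopology B] [DistribMulAction G B] [ContinuousSMul G B] (ι : B →+ A)
    (hι : Function.Injective ι) (hιG : ∀ (g : G) a, ι (g • a) = g • ι a) {p : ℕ}
    (z : cocycles μ A p) (hz : ∀ x, (z : Cochain μ A (p + 1)) x ∈ Set.range ι) :
    ∃ σ : (Fin (p + 1) → G) → A, Represents μ (QuotientAddGroup.mk z : Hm μ A p) σ ∧
      (∀ᶠ x in 𝓝 1, σ x = σ 1) ∧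
      ∃ (x₀ : Fin (p + 1) → G) (N : (Fin (p + 1) → G) → ℕ), IsLabel (𝒩 (p + 1)) x₀ N ∧
        ∀ x x', N x = N x' → σ x = σ x' := by
  let _ : MeasurableSpace B := ⊤
  have : DiscreteMeasurableSpace B := ⟨fun _ => trivial⟩
  obtain ⟨z, hzinv, hzd⟩ := z
  choose s hs using hz
  simp only at hs
  have hsm : Measurable s := by
    borelize A
    refine measurable_to_countable' fun a => ?_
    have h1 : MeasurableSet (z ⁻¹' {ι a}) :=
      z.stronglyMeasurable.measurable (isClosed_discrete _).measurableSet
    convert h1 using 1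
    ext x
    simp only [Set.mem_preimage, Set.mem_singleton_iff, ← hs, hι.eq_iff]
  obtain ⟨σ, hσm, hσe, hσs⟩ := exists_equivariant_ae_eq (μ := μ) hsm fun g => by
    have h1 := coeFn_act μ A (p + 1) g z
    rw [(mem_invariants μ A _ z).1 hzinv g] at h1
    filter_upwards [h1] with x hx
    refine hι ?_
    rw [hιG, hs, hs]
    exact hx.symm
  have hcob : ∀ {n : ℕ} (f : (Fin n → G) → B) x, coboundary (fun y => ι (f y)) x =
      ι (coboundary f x) := fun f x => by simp [coboundary, map_sum, map_zsmul]
  have hneg : ∀ (n : ℕ) (a : A), (-1 : ℤ) ^ n • (-1 : ℤ) ^ n • a = a := fun n a => by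
    rw [smul_smul, ← mul_pow]; simp
  have hσz : (fun x => ι (σ x)) =ᵐ[powMeasure μ (p + 1)] z := by
    filter_upwards [hσs] with x hx
    rw [hx, hs]
  have hface : ∀ᵐ x ∂powMeasure μ (p + 2), ∀ i : Fin (p + 2),
      ι (σ fun j => x (i.succAbove j)) = z fun j => x (i.succAbove j) :=
    ae_all_iff.2 fun i => (quasiMeasurePreserving_face μ (p + 1) i).ae hσz
  have hσ0 : ∀ᵐ x ∂powMeasure μ (p + 2), coboundary σ x = 0 := by
    have h1 := coeFn_d (p + 1) z
    rw [show d μ A (p + 1) z = 0 from hzd] at h1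
    filter_upwards [h1, hface, AEEqFun.coeFn_zero (μ := powMeasure μ (p + 2)) (β := A)]
      with x h2 h3 h4
    refine hι ?_
    rw [map_zero, ← hcob, coboundary_congr h3, ← hneg (p + 1) (coboundary z x), ← h2, h4]
    simp
  obtain ⟨σ', hσ'e, hσ'0, ⟨Q, hQm, hQe, hQ0, hQ⟩, hnear, x₀, N, hN, hNσ⟩ :=
    exists_isLabel_isCohomologous h𝒩 hσm hσe hσ0
  refine ⟨fun x => ι (σ' x), ⟨fun g x => by rw [hσ'e, hιG], fun x => ?_, ?_⟩, ?_, x₀, N, hN,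
    fun x x' hx => congrArg ι (hNσ x x' hx)⟩
  · have h1 := congrArg ((-1 : ℤ) ^ (p + 1) • ·) ((hcob σ' x).trans (by rw [hσ'0, map_zero]))
    simp only [smul_zero, coboundary, Finset.smul_sum, smul_smul, ← pow_add] at h1
    rw [← h1]
    refine Finset.sum_congr rfl fun i _ => ?_
    congr 1
    have hi : (i : ℕ) ≤ p + 1 := Nat.lt_succ_iff.1 i.2
    rw [show p + 1 + (i : ℕ) = p + 1 - i + 2 * i by omega, pow_add, pow_mul]
    simp
  · obtain ⟨w, hw, hwz⟩ : ∃ w ∈ coboundaries μ A p,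
        w =ᵐ[powMeasure μ (p + 1)] fun x => ι (coboundary Q x) := by
      cases p with
      | zero =>
        refine ⟨0, rfl, ?_⟩
        filter_upwards [AEEqFun.coeFn_zero (μ := powMeasure μ (0 + 1)) (β := A)] with x hx
        rw [hx, hQ0 rfl]
        simp [coboundary]
      | succ q =>
        -- The sign cancels the factor between `d` and `coboundary`.
        let R : (Fin (q + 1) → G) → B := fun x => (-1 : ℤ) ^ (q + 1) • Q x
        have hRs : AEStronglyMeasurable (fun x => ι (R x)) (powMeasure μ (q + 1)) := by
          have : OpensMeasurableSpace B := ⟨fun _ _ => trivial⟩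
          have hR : Measurable R := (measurable_of_countable fun b : B => _ • b).comp hQm
          exact ((continuous_of_discreteTopology (f := ι)).comp_stronglyMeasurable
            hR.stronglyMeasurable).aestronglyMeasurable
        have hmk := AEEqFun.coeFn_mk _ hRs
        refine ⟨d μ A (q + 1) (AEEqFun.mk _ hRs), ⟨_, (mem_invariants μ A _ _).2 fun g =>
          AEEqFun.ext ((coeFn_act μ A _ _ _).trans ?_), rfl⟩, ?_⟩
        · filter_upwards [hmk,
            (measurePreserving_diag μ (q + 1) g⁻¹).quasiMeasurePreserving.ae hmk] with x h1 h2
          rw [h1, h2]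
          simp only [R, hQe, hιG, map_zsmul]
          rw [smul_comm, smul_inv_smul]
        · filter_upwards [coeFn_d (q + 1) (AEEqFun.mk _ hRs), ae_all_iff.2 fun i : Fin (q + 2) =>
            (quasiMeasurePreserving_face μ (q + 1) i).ae hmk] with x h1 h2
          rw [h1, coboundary_congr (g := fun x => ι (R x)) h2, hcob, coboundary_zsmul, map_zsmul, hneg]
    have hwz' := coboundaries_le_cocycles μ A p hw
    refine ⟨⟨z, hzinv, hzd⟩ - ⟨w, hwz'⟩, ?_, ?_⟩
    · refine QuotientAddGroup.eq.2 (AddSubgroup.mem_addSubgroupOf.2 ?_)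
      simpa using hw
    · refine (AEEqFun.coeFn_sub z w).trans ?_
      filter_upwards [hσz, hwz, hQ] with x h1 h2 h3
      rw [Pi.sub_apply, ← h1, h2, h3, map_add, add_sub_cancel_right]
  · filter_upwards [hnear] with x hx
    rw [hx]

end Reduction

/-! ### Reduction to countable submodules -/

section Final

variable {G : Type*} [Group G] [TopologicalSpace G] [IsTopologicalGroup G] [LocallyCompactSpace G]
  [SecondCountableTopology G] [T2Space G] [MeasurableSpace G] [BorelSpace G] {μ : Measure G}
  [μ.IsHaarMeasure] {A : Type*} [AddCommGroup A] [TopologicalSpace A] [DiscreteTopology A]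
  [DistribMulAction G A] [ContinuousSMul G A]

theorem countable_of_isSeparable {s : Set A} (hs : TopologicalSpace.IsSeparable s) :
    s.Countable := by
  obtain ⟨c, hc, hsc⟩ := hs
  rw [closure_discrete] at hsc
  exact hc.mono hsc

theorem countable_orbit (a : A) : (Set.range fun g : G => g • a).Countable :=
  countable_of_isSeparable (TopologicalSpace.isSeparable_range (by fun_prop))

/-- A strongly measurable function has separable, hence countable, range in the discrete module.
Orbits are countable because `G` is separable, so the submodule generated by the orbits of the
values is countable and stable under `G`. -/
theorem exists_represents {𝒩 : ∀ q : ℕ, Set (Set (Fin q → G))} (h𝒩 : IsTameSystem μ 𝒩) {p : ℕ}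
    (c : Hm μ A p) :
    ∃ σ : (Fin (p + 1) → G) → A, Represents μ c σ ∧ (∀ᶠ x in 𝓝 1, σ x = σ 1) ∧
      ∃ (x₀ : Fin (p + 1) → G) (N : (Fin (p + 1) → G) → ℕ), IsLabel (𝒩 (p + 1)) x₀ N ∧
        ∀ x x', N x = N x' → σ x = σ x' := by
  obtain ⟨z, rfl⟩ := QuotientAddGroup.mk_surjective c
  have hR : (Set.range (z : Cochain μ A (p + 1))).Countable :=
    countable_of_isSeparable (z : Cochain μ A (p + 1)).stronglyMeasurable.isSeparable_range
  let S : Set A := ⋃ a ∈ Set.range (z : Cochain μ A (p + 1)), Set.range fun g : G => g • a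
  have hS : S.Countable := hR.biUnion fun a _ => countable_orbit a
  have hSG : ∀ g : G, ∀ a ∈ S, g • a ∈ S := by
    intro g a ha
    obtain ⟨r, hr, k, rfl⟩ := Set.mem_iUnion₂.1 ha
    exact Set.mem_iUnion₂.2 ⟨r, hr, g * k, mul_smul g k r⟩
  let M : Submodule ℤ A := Submodule.span ℤ S
  have hMc : Countable M := by
    have := hS.to_subtype
    have h1 : (M : Set A).Countable := by
      rw [show (M : Set A) = Set.range (Finsupp.linearCombination ℤ ((↑) : S → A)) by
        rw [← LinearMap.coe_range, Finsupp.range_linearCombination, Subtype.range_coe]]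
      exact Set.countable_range _
    exact h1.to_subtype
  have hMG : ∀ g : G, ∀ a ∈ M, g • a ∈ M := by
    intro g a ha
    induction ha using Submodule.span_induction with
    | mem a ha => exact Submodule.subset_span (hSG g a ha)
    | zero => rw [smul_zero]; exact M.zero_mem
    | add a b _ _ h1 h2 => rw [smul_add]; exact M.add_mem h1 h2
    | smul n a _ h => rw [smul_comm]; exact M.smul_mem n h
  let _ : DistribMulAction G M :=
    { smul := fun g a => ⟨g • (a : A), hMG g a a.2⟩
      one_smul := fun a => Subtype.ext (one_smul G (a : A))
      mul_smul := fun g h a => Subtype.ext (mul_smul g h (a : A))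
      smul_zero := fun g => Subtype.ext (smul_zero g)
      smul_add := fun g a b => Subtype.ext (smul_add g (a : A) b) }
  have : ContinuousSMul G M :=
    ⟨(continuous_fst.smul (continuous_subtype_val.comp continuous_snd)).subtype_mk _⟩
  refine exists_represents_of_countable h𝒩 M.subtype.toAddMonoidHom Subtype.val_injective
    (fun _ _ => rfl) z fun x => ⟨⟨_, Submodule.subset_span (Set.mem_iUnion₂.2
      ⟨_, ⟨x, rfl⟩, 1, one_smul G _⟩)⟩, rfl⟩

theorem isStableSystem_univ : IsStableSystem fun q => (Set.univ : Set (Set (Fin q → G))) where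
  compl _ _ _ := trivial
  inter _ _ _ _ _ := trivial
  sublevel q x U hU := by
    let _ : MetricSpace (Fin q → G) := TopologicalSpace.metrizableSpaceMetric _
    obtain ⟨ε, hε, h⟩ := Metric.mem_nhds_iff.1 hU
    exact ⟨fun z => dist z x, by fun_prop, dist_self x, fun _ => trivial, ε, hε, h⟩
  face _ _ _ _ := trivial
  quot _ _ _ := trivial
  mul_right _ _ _ _ := trivial

end Final

end MooreCohomology

/-! ### Semi-algebraic sets -/

section Semialgebraic

theorem IsSemialgebraic.univ {ι : Type*} : IsSemialgebraic (Set.univ : Set (ι → ℝ)) := by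
  convert IsSemialgebraic.pos (ι := ι) 1
  ext
  simp

theorem IsSemialgebraic.eq_zero {ι : Type*} (f : MvPolynomial ι ℝ) :
    IsSemialgebraic {x | MvPolynomial.eval x f = 0} := by
  convert (IsSemialgebraic.pos f).compl.inter (IsSemialgebraic.pos (-f)).compl
  ext x
  simp only [map_neg, Left.neg_pos_iff, Set.mem_inter_iff, Set.mem_compl_iff, Set.mem_ofPred_eq,
    not_lt]
  exact le_antisymm_iff

theorem IsSemialgebraic.forall_mem {ι κ : Type*} (s : Finset κ) {S : κ → Set (ι → ℝ)}
    (h : ∀ k ∈ s, IsSemialgebraic (S k)) : IsSemialgebraic {x | ∀ k ∈ s, x ∈ S k} := by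
  classical
  induction s using Finset.induction_on with
  | empty => simpa using IsSemialgebraic.univ
  | insert a s _ ih =>
    convert (h a (Finset.mem_insert_self _ _)).inter
      (ih fun k hk => h k (Finset.mem_insert_of_mem hk)) using 1
    ext x
    simp

/-- Clearing denominators: on the set where the polynomial `D` does not vanish, the value of a
polynomial at the quotients `r i / D` is a polynomial divided by a power of `D`. -/
theorem MvPolynomial.exists_pow_mul_eval_div {ι κ : Type*} (r : ι → MvPolynomial κ ℝ)
    (D : MvPolynomial κ ℝ) (f : MvPolynomial ι ℝ) :
    ∃ (N : ℕ) (g : MvPolynomial κ ℝ), ∀ x, MvPolynomial.eval x D ≠ 0 →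
      MvPolynomial.eval x D ^ N *
        MvPolynomial.eval (fun i => MvPolynomial.eval x (r i) / MvPolynomial.eval x D) f =
      MvPolynomial.eval x g := by
  induction f using MvPolynomial.induction_on with
  | C a => exact ⟨0, MvPolynomial.C a, fun x _ => by simp⟩
  | add f g hf hg =>
    obtain ⟨N, u, hu⟩ := hf
    obtain ⟨M, v, hv⟩ := hg
    refine ⟨N + M, D ^ M * u + D ^ N * v, fun x hx => ?_⟩
    simp only [map_add, map_mul, map_pow, ← hu x hx, ← hv x hx]
    ring
  | mul_X f i hf =>
    obtain ⟨N, u, hu⟩ := hf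
    refine ⟨N + 1, u * r i, fun x hx => ?_⟩
    simp only [map_mul, ← hu x hx, MvPolynomial.eval_X]
    field_simp
    ring

/-- The preimage of a semi-algebraic set under a map given by quotients of polynomials is, on the
set where the map is defined, a semi-algebraic set. -/
theorem IsSemialgebraic.exists_preimage_div {ι κ : Type*} {S : Set (ι → ℝ)} (hS : IsSemialgebraic S)
    (r : ι → MvPolynomial κ ℝ) (D : MvPolynomial κ ℝ) :
    ∃ T, IsSemialgebraic T ∧ ∀ x, MvPolynomial.eval x D ≠ 0 →
      (x ∈ T ↔ (fun i => MvPolynomial.eval x (r i) / MvPolynomial.eval x D) ∈ S) := by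
  induction hS with
  | pos f =>
    obtain ⟨N, g, hg⟩ := MvPolynomial.exists_pow_mul_eval_div r D f
    -- An odd power of `D` could change the sign; multiplying by `D ^ N` once more leaves the
    -- positive factor `D ^ (2N)`.
    refine ⟨_, IsSemialgebraic.pos (D ^ N * g), fun x hx => ?_⟩
    simp only [Set.mem_ofPred_eq, map_mul, map_pow, ← hg x hx]
    rw [← mul_assoc, ← mul_pow]
    exact mul_pos_iff_of_pos_left (pow_pos (mul_self_pos.2 hx) N)
  | compl _ ih =>
    obtain ⟨T, hT, h⟩ := ih
    exact ⟨_, hT.compl, fun x hx => not_congr (h x hx)⟩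
  | inter _ _ ih ih' =>
    obtain ⟨T, hT, h⟩ := ih
    obtain ⟨T', hT', h'⟩ := ih'
    exact ⟨_, hT.inter hT', fun x hx => and_congr (h x hx) (h' x hx)⟩

variable {G : Type*} [Group G] {n : ℕ} (ρ : G →* GL (Fin n) ℝ)

/-- The preimages of semi-algebraic sets under the matrix coordinates. -/
def semialgebraicSystem (q : ℕ) : Set (Set (Fin q → G)) :=
  {C | ∃ S, IsSemialgebraic S ∧ C = matrixCoords ρ q ⁻¹' S}

/-- In coordinates `f` is given by quotients `r k / D` whose denominator has no zeros on the image
of `G`, so the unspecified behaviour on `D = 0` is irrelevant. -/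
theorem preimage_mem_semialgebraicSystem {m q : ℕ} {f : (Fin m → G) → Fin q → G}
    (r : Fin q × Fin n × Fin n → MvPolynomial (Fin m × Fin n × Fin n) ℝ)
    (D : MvPolynomial (Fin m × Fin n × Fin n) ℝ)
    (hD : ∀ x, MvPolynomial.eval (matrixCoords ρ m x) D ≠ 0)
    (hf : ∀ x k, matrixCoords ρ q (f x) k * MvPolynomial.eval (matrixCoords ρ m x) D =
      MvPolynomial.eval (matrixCoords ρ m x) (r k)) {C : Set (Fin q → G)}
    (hC : C ∈ semialgebraicSystem ρ q) : f ⁻¹' C ∈ semialgebraicSystem ρ m := by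
  obtain ⟨S, hS, rfl⟩ := hC
  obtain ⟨T, hT, h⟩ := hS.exists_preimage_div r D
  refine ⟨T, hT, ?_⟩
  ext x
  rw [Set.mem_preimage, Set.mem_preimage, Set.mem_preimage, h _ (hD x)]
  have : matrixCoords ρ q (f x) = fun i => MvPolynomial.eval (matrixCoords ρ m x) (r i) /
      MvPolynomial.eval (matrixCoords ρ m x) D := by
    funext k
    rw [← hf x k, mul_div_cancel_right₀ _ (hD x)]
  rw [this]

/-- The generic matrix in the `i`-th factor. -/
noncomputable def coordMatrix (n q : ℕ) (i : Fin q) :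
    Matrix (Fin n) (Fin n) (MvPolynomial (Fin q × Fin n × Fin n) ℝ) :=
  Matrix.of fun a b => MvPolynomial.X (i, a, b)

theorem map_coordMatrix (q : ℕ) (x : Fin q → G) (i : Fin q) :
    (coordMatrix n q i).map (MvPolynomial.eval (matrixCoords ρ q x)) =
      (ρ (x i) : Matrix (Fin n) (Fin n) ℝ) := by
  ext a b
  simp [coordMatrix, matrixCoords]

theorem eval_det_coordMatrix (q : ℕ) (w : Fin q × Fin n × Fin n → ℝ) (i : Fin q) :
    MvPolynomial.eval w (coordMatrix n q i).det = (Matrix.of fun a b => w (i, a, b)).det := by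
  rw [RingHom.map_det]
  congr 1
  ext a b
  simp [coordMatrix]

theorem IsAlgebraicSubgroup.isSemialgebraic_range (hρ : IsAlgebraicSubgroup ρ.range) (q : ℕ) :
    IsSemialgebraic (Set.range (matrixCoords ρ q)) := by
  obtain ⟨S, hS⟩ := hρ
  -- Hilbert's basis theorem: semi-algebraic sets allow only finitely many equations.
  obtain ⟨T, hT⟩ : (Ideal.span S).FG := IsNoetherian.noetherian _
  have hST : ∀ w : Fin n × Fin n → ℝ, (∀ f ∈ S, MvPolynomial.eval w f = 0) ↔
      ∀ f ∈ T, MvPolynomial.eval w f = 0 := by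
    intro w
    have h1 : ∀ U : Set (MvPolynomial (Fin n × Fin n) ℝ), (∀ f ∈ U, MvPolynomial.eval w f = 0) ↔
        Ideal.span U ≤ RingHom.ker (MvPolynomial.eval w) := fun U => by
      rw [Ideal.span_le]; rfl
    rw [h1 S, ← hT, ← h1]
    rfl
  have h1 : Set.range (matrixCoords ρ q) = {w | ∀ i ∈ (Finset.univ : Finset (Fin q)),
      w ∈ {w | MvPolynomial.eval w (coordMatrix n q i).det = 0}ᶜ ∩ {w | ∀ f ∈ T,
        w ∈ {w | MvPolynomial.eval w (MvPolynomial.rename (fun k => (i, k)) f) = 0}}} := by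
    ext w
    simp only [Set.mem_range, Finset.mem_univ, forall_true_left, Set.mem_inter_iff,
      Set.mem_compl_iff, Set.mem_ofPred_eq, eval_det_coordMatrix, MvPolynomial.eval_rename]
    constructor
    · rintro ⟨x, rfl⟩ i
      refine ⟨((Matrix.isUnit_iff_isUnit_det _).1 (ρ (x i)).isUnit).ne_zero, ?_⟩
      exact (hST fun k => (ρ (x i) : Matrix (Fin n) (Fin n) ℝ) k.1 k.2).1 ((hS _).1 ⟨x i, rfl⟩)
    · intro h
      have h2 : ∀ i, ∃ g : G, ∀ a b, (ρ g : Matrix (Fin n) (Fin n) ℝ) a b = w (i, a, b) := by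
        intro i
        obtain ⟨h3, h4⟩ := h i
        obtain ⟨u, hu⟩ : ∃ u : GL (Fin n) ℝ, ∀ a b, (u : Matrix (Fin n) (Fin n) ℝ) a b =
            w (i, a, b) := ⟨Matrix.GeneralLinearGroup.mkOfDetNeZero _ h3, fun _ _ => rfl⟩
        have h5 : (fun k : Fin n × Fin n => (u : Matrix (Fin n) (Fin n) ℝ) k.1 k.2) =
            w ∘ fun k => (i, k) := funext fun k => hu _ _
        obtain ⟨g, hg⟩ := (hS u).2 (by rw [h5]; exact (hST _).2 h4)
        exact ⟨g, fun a b => by rw [hg, hu]⟩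
      choose x hx using h2
      refine ⟨x, ?_⟩
      funext k
      simp [matrixCoords, hx]
  rw [h1]
  exact IsSemialgebraic.forall_mem _ fun i _ => (IsSemialgebraic.eq_zero _).compl.inter
    (IsSemialgebraic.forall_mem _ fun f _ => IsSemialgebraic.eq_zero _)

theorem isSemialgebraic_image (hρ : IsAlgebraicSubgroup ρ.range) {q : ℕ} {C : Set (Fin q → G)}
    (hC : C ∈ semialgebraicSystem ρ q) : IsSemialgebraic (matrixCoords ρ q '' C) := by
  obtain ⟨S, hS, rfl⟩ := hC
  rw [Set.image_preimage_eq_inter_range]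
  exact hS.inter (hρ.isSemialgebraic_range ρ q)

variable [TopologicalSpace G]

/-- By Cramer's rule inversion is continuous in the entries, so the unit topology on `GL_n(ℝ)` is
the one induced from matrices. -/
theorem isInducing_matrixCoords (hρ : Topology.IsInducing ρ) (q : ℕ) :
    Topology.IsInducing (matrixCoords ρ q) := by
  have h1 : Topology.IsInducing (Units.val : GL (Fin n) ℝ → Matrix (Fin n) (Fin n) ℝ) := by
    refine (Units.isEmbedding_val_mk' (f := fun M => M⁻¹) ?_ fun u => ?_).isInducing
    · have h2 : ContinuousOn (fun M : Matrix (Fin n) (Fin n) ℝ => M.det⁻¹ • M.adjugate)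
          {M | IsUnit M} :=
        (ContinuousOn.inv₀ continuous_id.matrix_det.continuousOn fun M hM =>
          ((Matrix.isUnit_iff_isUnit_det M).1 hM).ne_zero).smul
          continuous_id.matrix_adjugate.continuousOn
      refine h2.congr fun M _ => ?_
      rw [Matrix.inv_def, Ring.inverse_eq_inv']
    · exact (Matrix.coe_units_inv u).symm
  have h2 : Topology.IsInducing fun (x : Fin q → G) i => (ρ (x i) : Matrix (Fin n) (Fin n) ℝ) :=
    Topology.IsInducing.piMap fun _ => h1.comp hρ
  have h3 : Function.LeftInverse
      (fun (v : Fin q × Fin n × Fin n → ℝ) i => Matrix.of fun a b => v (i, a, b))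
      (fun (w : Fin q → Matrix (Fin n) (Fin n) ℝ) k => w k.1 k.2.1 k.2.2) := fun _ => rfl
  exact (h3.isEmbedding (by fun_prop) (by fun_prop)).isInducing.comp h2

/-- Squared Euclidean distance is a polynomial and gives the sublevel sets; the quotient map is
rational with denominator the determinant of the first matrix, through the adjugate. -/
theorem isStableSystem_semialgebraic (hρ : Topology.IsInducing ρ) :
    MooreCohomology.IsStableSystem (semialgebraicSystem ρ) where
  compl q C hC := by
    obtain ⟨S, hS, rfl⟩ := hC
    exact ⟨_, hS.compl, rfl⟩
  inter q C hC D hD := by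
    obtain ⟨S, hS, rfl⟩ := hC
    obtain ⟨T, hT, rfl⟩ := hD
    exact ⟨_, hS.inter hT, rfl⟩
  sublevel q x U hU := by
    have hi := isInducing_matrixCoords ρ hρ q
    have hc := hi.continuous
    rw [hi.nhds_eq_comap] at hU
    obtain ⟨V, hV, hVU⟩ := hU
    obtain ⟨ε, hε, hεV⟩ := Metric.mem_nhds_iff.1 hV
    refine ⟨fun z => ∑ k, (matrixCoords ρ q z k - matrixCoords ρ q x k) ^ 2, by fun_prop, by simp,
      fun r => ⟨_, IsSemialgebraic.pos (MvPolynomial.C r -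
        ∑ k, (MvPolynomial.X k - MvPolynomial.C (matrixCoords ρ q x k)) ^ 2), ?_⟩, ε ^ 2,
      by positivity, fun z hz => hVU (hεV ?_)⟩
    · ext z
      simp
    · rw [Metric.mem_ball, dist_pi_lt_iff hε]
      intro k
      rw [Real.dist_eq]
      refine abs_lt_of_sq_lt_sq (lt_of_le_of_lt ?_ hz) hε.le
      exact Finset.single_le_sum (f := fun k => (matrixCoords ρ q z k - matrixCoords ρ q x k) ^ 2)
        (fun _ _ => sq_nonneg _) (Finset.mem_univ k)
  face q i C hC := preimage_mem_semialgebraicSystem ρ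
    (fun k => MvPolynomial.X (i.succAbove k.1, k.2)) 1 (by simp)
    (by simp [matrixCoords]) hC
  quot q C hC := by
    refine preimage_mem_semialgebraicSystem ρ
      (fun k => ((coordMatrix n (q + 1) 0).adjugate * coordMatrix n (q + 1) k.1.succ) k.2.1 k.2.2)
      (coordMatrix n (q + 1) 0).det (fun x => ?_) (fun x k => ?_) hC
    · rw [RingHom.map_det, RingHom.mapMatrix_apply, map_coordMatrix]
      exact ((Matrix.isUnit_iff_isUnit_det _).1 (ρ (x 0)).isUnit).ne_zero
    · have h1 : (ρ (x k.1.succ) : Matrix (Fin n) (Fin n) ℝ) =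
          ρ (x 0) * ρ ((x 0)⁻¹ * x k.1.succ) := by
        rw [← Units.val_mul, ← map_mul, mul_inv_cancel_left]
      rw [RingHom.map_det, RingHom.mapMatrix_apply, map_coordMatrix, ← Matrix.map_apply
        (f := MvPolynomial.eval (matrixCoords ρ (q + 1) x)), Matrix.map_mul, ← RingHom.mapMatrix_apply,
        RingHom.map_adjugate, RingHom.mapMatrix_apply, map_coordMatrix, map_coordMatrix, h1,
        ← Matrix.mul_assoc, Matrix.adjugate_mul, Matrix.smul_mul, Matrix.one_mul, Matrix.smul_apply,
        smul_eq_mul, mul_comm]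
      rfl
  mul_right q h C hC := by
    let H : Matrix (Fin n) (Fin n) (MvPolynomial (Fin q × Fin n × Fin n) ℝ) :=
      (ρ h : Matrix (Fin n) (Fin n) ℝ).map MvPolynomial.C
    refine preimage_mem_semialgebraicSystem ρ (fun k => (coordMatrix n q k.1 * H) k.2.1 k.2.2)
      1 (by simp) (fun x k => ?_) hC
    have h1 : H.map (MvPolynomial.eval (matrixCoords ρ q x)) = ρ h := by
      ext a b
      simp [H]
    rw [map_one, mul_one, ← Matrix.map_apply (f := MvPolynomial.eval (matrixCoords ρ q x)),
      Matrix.map_mul, map_coordMatrix, h1, ← Units.val_mul, ← map_mul]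
    rfl

end Semialgebraic

/-! ### The theorem, from the systems of all and of semi-algebraic sets -/

theorem theoremC {G : Type*} [Group G] [TopologicalSpace G] [IsTopologicalGroup G]
    [LocallyCompactSpace G] [SecondCountableTopology G] [T2Space G]
    [MeasurableSpace G] [BorelSpace G] (μ : MeasureTheory.Measure G) [μ.IsHaarMeasure]
    {A : Type*} [AddCommGroup A] [TopologicalSpace A] [DiscreteTopology A]
    [DistribMulAction G A] [ContinuousSMul G A] :
    (∀ (p : ℕ) (c : MooreCohomology.Hm μ A p), ∃ σ : (Fin (p + 1) → G) → A,
      MooreCohomology.Represents μ c σ ∧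
      LocallyFiniteValued σ ∧
      LocallyConstantOnFullDenseOpen (MooreCohomology.powMeasure μ (p + 1)) σ) ∧
    (∀ (n : ℕ) (ρ : G →* GL (Fin n) ℝ), Topology.IsClosedEmbedding ρ →
      IsAlgebraicSubgroup ρ.range →
      ∀ (p : ℕ) (c : MooreCohomology.Hm μ A p), ∃ σ : (Fin (p + 1) → G) → A,
        MooreCohomology.Represents μ c σ ∧
        LocallyFiniteValued σ ∧
        LocallyConstantOnFullDenseOpen (MooreCohomology.powMeasure μ (p + 1)) σ ∧
        IsSemialgebraicallyPartitioned ρ σ ∧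
        ∀ᶠ x in nhds (1 : Fin (p + 1) → G), σ x = σ 1) := by
  refine ⟨fun p c => ?_, fun n ρ hρ hρa p c => ?_⟩
  · have h𝒩 := MooreCohomology.isStableSystem_univ.isTameSystem μ
    obtain ⟨σ, hσ, -, x₀, N, hN, hNσ⟩ := MooreCohomology.exists_represents h𝒩 c
    exact ⟨σ, hσ, hN.locallyFiniteValued hNσ,
      hN.locallyConstantOnFullDenseOpen (h𝒩.null_frontier _) hNσ⟩
  · have h𝒩 := (isStableSystem_semialgebraic ρ hρ.isInducing).isTameSystem μ
    obtain ⟨σ, hσ, hnear, x₀, N, hN, hNσ⟩ := MooreCohomology.exists_represents h𝒩 c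
    obtain ⟨P, hP, hPf, hP𝒩, hPσ⟩ := hN.exists_isPartition hNσ
    exact ⟨σ, hσ, hN.locallyFiniteValued hNσ,
      hN.locallyConstantOnFullDenseOpen (h𝒩.null_frontier _) hNσ,
      ⟨P, hP, hPf, fun C hC => isSemialgebraic_image ρ hρa (hP𝒩 C hC).1, hPσ⟩, hnear⟩
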